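/- **Setting.** Let $\mathcal X\subset\mathbb R^d$ be compact, $\mu$ a Borel probability measure on $\mathcal X$, and $\mathcal K:\mathcal X\times\mathcal X\to[0,1]$ a continuous symmetric kernel such that the eigenvalues of the integral operator $(Tf)(x)=\int_{\mathcal X}\mathcal K(x,y)f(y)\,d\mu(y)$ on $L^2(\mu)$ lie in $[0,1]$, and such that $\mathcal K(x,x)=c$ for all $x\in\mathcal X$, where $c$ is a constant. For $n\ge 1$ and a sparsity level $\alpha_n\in(0,1]$, let $x_1,\dots,x_n$ be i.i.d. with law $\mu$ and let $A=(a_{ij})\in\{0,1\}^{n\times n}$ be symmetric such that, conditionally on $x_1,\dots,x_n$, the entries $a_{ij}$, $1\le i\le j\le n$, are independent with $a_{ij}\sim\mathrm{Ber}(\alpha_n\mathcal K(x_i,x_j))$. Write $\mathcal K_{|X_n\times X_n}=(\mathcal K(x_i,x_j))_{i,j=1}^n$ for the Gram matrix, $\|\cdot\|_F$ for the Frobenius norm and $\lambda_{\max}$ for the largest eigenvalue. Given the eigendecomposition $A=\sum_{i=1}^n\lambda_iu_iu_i^t$ and a threshold $\gamma_n\ge0$, put $$\widetilde A=\frac1{\alpha_n}\sum_{i:\,\lambda_i\ge\gamma_n}\lambda_iu_iu_i^t,\qquad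 \bar A=\widetilde A+\max\Big(c-\frac{\mathrm{tr}(\widetilde A)}n,\,0\Big)I,$$ $$K_n=\min\Big(\frac n{\lambda_{\max}(\bar A)},\ \Big(1+\frac1{(\alpha_nn)^{1/4}}\Big)^{-1}\Big)\bar A$$ (with $K_n=0$ if $\bar A=0$). **Proposition.** Assume $\alpha_n\gtrsim\log n/n$, that is, $\alpha_n\ge\kappa\log n/n$ for some constant $\kappa>0$. For every $q>0$ there exist constants $\rho_q,b_q,B_q>0$, depending only on $q$ and $\kappa$, such that, for all $\delta\in(0,1)$ and $\varepsilon>0$ and for $\gamma_n=\rho_q(\alpha_nn)^{3/4}$, $$n\ge\max\Big(\frac1{\delta^q},\ \frac{b_q}{\alpha_n\varepsilon^8},\ \frac{B_q}{\alpha_n\varepsilon^4}\Big)$$ implies $$\mathbb P\left(\max\left(\Big\|\tfrac{K_n-\mathcal K_{|X_n\times X_n}}n\Big\|_F,\ \Big|\mathrm{tr}\big(\tfrac{K_n}n\big)-\mathrm{tr}\big(\tfrac{\mathcal K_{|X_n\times X_n}}n\big)\Big|\right)\ge\varepsilon\right)\le\delta .$$ -/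

import Mathlib

open MeasureTheory ProbabilityTheory

/-- The real number `l` is an eigenvalue of the integral operator
`(T_W f)(x) = ∫ W(x, y) f(y) dμ(y)` acting on `L²(μ)`: some `f ∈ L²(μ)` that does not vanish
almost everywhere satisfies `T_W f = l f` in `L²(μ)`. -/
def IsIntegralOperatorEigenvalue {S : Type*} [MeasurableSpace S] (μ : Measure S)
    (W : S → S → ℝ) (l : ℝ) : Prop :=
  ∃ f : S → ℝ, MemLp f 2 μ ∧ ¬ f =ᵐ[μ] 0 ∧
    (fun x => ∫ y, W x y * f y ∂μ) =ᵐ[μ] fun x => l * f x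

/-- `W : S × S → [0, 1]` is a connectivity kernel that is also a valid kernel of a determinantal
point process with respect to `μ`: it is continuous and symmetric, and the eigenvalues of its
integral operator on `L²(μ)` lie in `[0, 1]`. -/
structure IsConnectivityKernel {S : Type*} [TopologicalSpace S] [MeasurableSpace S]
    (μ : Measure S) (W : S → S → ℝ) : Prop where
  mem_Icc : ∀ x y, W x y ∈ Set.Icc (0 : ℝ) 1
  continuous : Continuous fun p : S × S => W p.1 p.2
  symm : ∀ x y, W x y = W y x
  eigenvalue_mem_Icc : ∀ l : ℝ, IsIntegralOperatorEigenvalue μ W l → l ∈ Set.Icc (0 : ℝ) 1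

/-- On the probability space `(Ω, P)`, the matrix `A` is the adjacency matrix of a latent position
random graph with latent positions `X 0, …, X (n - 1)`, connectivity kernel `W`, sparsity
level `α` and position distribution `μ`: the positions are iid with law `μ`; `A` is symmetric with
entries in `{0, 1}`; and, conditionally on the positions, the entries `A i j` with `i ≤ j` are
independent Bernoulli variables of parameters `α * W (X i) (X j)`. -/
structure IsLatentPositionGraph {S Ω : Type*} [MeasurableSpace S] [MeasurableSpace Ω]
    (P : Measure Ω) (μ : Measure S) (W : S → S → ℝ) (α : ℝ) {n : ℕ}
    (X : Fin n → Ω → S) (A : Ω → Matrix (Fin n) (Fin n) ℝ) : Prop where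
  measurable_position : ∀ i, Measurable (X i)
  indep_position : iIndepFun X P
  law_position : ∀ i, P.map (X i) = μ
  measurable_entry : ∀ i j, Measurable fun ω => A ω i j
  isHermitian : ∀ ω, (A ω).IsHermitian
  entry_eq : ∀ ω i j, A ω i j = 0 ∨ A ω i j = 1
  /-- The conditional law of the edges given the positions: for every measurable event `C` on the
  positions and every pattern `B` of edges and non-edges, the probability that the positions lie
  in `C` and that the edges follow the pattern `B` is the integral over `C` of the product of the
  corresponding Bernoulli weights. -/
  cond_law : ∀ (C : Set (Fin n → S)), MeasurableSet C → ∀ B : Fin n → Fin n → Bool,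
    P ({ω | (fun i => X i ω) ∈ C} ∩
        {ω | ∀ i j, i ≤ j → A ω i j = if B i j then 1 else 0}) =
      ∫⁻ ω in {ω | (fun i => X i ω) ∈ C},
        ∏ i : Fin n, ∏ j ∈ Finset.Ici i, ENNReal.ofReal
          (if B i j then α * W (X i ω) (X j ω) else 1 - α * W (X i ω) (X j ω)) ∂P

open scoped Matrix.Norms.Frobenius in
/-- The Frobenius norm of a real matrix. -/
noncomputable def frobeniusNorm {n : ℕ} (M : Matrix (Fin n) (Fin n) ℝ) : ℝ := ‖M‖

theorem frobeniusNorm_eq {n : ℕ} (M : Matrix (Fin n) (Fin n) ℝ) :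
    frobeniusNorm M = Real.sqrt (∑ i, ∑ j, M i j ^ 2) := by
  simp [frobeniusNorm, Matrix.frobenius_norm_def, Real.sqrt_eq_rpow]

/-- The Gram matrix `[W(x_i, x_j)]_{i,j}`. -/
def gramMatrix {S : Type*} {n : ℕ} (W : S → S → ℝ) (x : Fin n → S) :
    Matrix (Fin n) (Fin n) ℝ :=
  Matrix.of fun i j => W (x i) (x j)

/-- The largest eigenvalue of a symmetric real matrix. -/
noncomputable def lambdaMax {n : ℕ} (M : Matrix (Fin n) (Fin n) ℝ) : ℝ :=
  sSup (spectrum ℝ M)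

/-- The universal singular value thresholding estimator
`α⁻¹ ∑_{i : λ_i ≥ γ} λ_i u_i u_iᵗ`, where `A = ∑_i λ_i u_i u_iᵗ` is the eigendecomposition of the
symmetric matrix `A`. -/
noncomputable def usvtEstimator {n : ℕ} (α γ : ℝ) (A : Matrix (Fin n) (Fin n) ℝ)
    (hA : A.IsHermitian) : Matrix (Fin n) (Fin n) ℝ :=
  (1 / α) • ∑ i with γ ≤ hA.eigenvalues i,
    hA.eigenvalues i • Matrix.vecMulVec (hA.eigenvectorBasis i) (hA.eigenvectorBasis i)

/-- The diagonal trace correction `M + max (c - tr(M) / n, 0) I`. -/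
noncomputable def traceCorrection {n : ℕ} (c : ℝ) (M : Matrix (Fin n) (Fin n) ℝ) :
    Matrix (Fin n) (Fin n) ℝ :=
  M + max (c - M.trace / n) 0 • (1 : Matrix (Fin n) (Fin n) ℝ)

/-- The spectral rescaling `min (n / λ_max(M), (1 + (α n)^(-1/4))⁻¹) M`. It is applied to positive
semidefinite matrices `M`, for which `λ_max(M) = 0` only if `M = 0`. -/
noncomputable def spectralRescaling {n : ℕ} (α : ℝ) (M : Matrix (Fin n) (Fin n) ℝ) :
    Matrix (Fin n) (Fin n) ℝ :=
  min ((n : ℝ) / lambdaMax M) (1 + 1 / (α * n) ^ (1 / 4 : ℝ))⁻¹ • M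

/-- The modified estimator `K_n` built from the adjacency matrix `A`, the sparsity level `α`, the
diagonal value `c` of the kernel and the threshold `γ`. -/
noncomputable def usvtKernel {n : ℕ} (α c γ : ℝ) (A : Matrix (Fin n) (Fin n) ℝ)
    (hA : A.IsHermitian) : Matrix (Fin n) (Fin n) ℝ :=
  spectralRescaling α (traceCorrection c (usvtEstimator α γ A hA))

/-!
The proof combines a sharp spectral concentration bound with a deterministic analysis of the
thresholding step.

*Concentration.* Up to a probability `n ^ (-1 / q)`, the adjacency matrix is within `C √(α n)` of
`α K` in spectral norm, where `K` is the Gram matrix (`exists_spectral_concentration`). This is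
Markov's inequality for the trace of the power `2 k` of the centred matrix, with `k` a large multiple
of `α n`, hence at least a multiple of `log n`. The expected trace is a sum over closed walks of length `2 k`; only walks
that use no edge exactly once contribute, and a walk through `m` vertices contributes at most
`α ^ (m - 1)` (`sum_prod_mul_trace_le`). Such walks visit at most `k + 1` vertices, so relabelling
their vertices compares the weighted number of walks on `n` vertices with the number of walks on
only `2 k` vertices (`sum_goodWalks_le`). That number is itself at most the expected trace of a matrix
of size `2 k` with independent entries in `{-1, 2}`, to which a net argument applies: the union bound
over a net of size `exp (O(k))` costs nothing here, because the order of the moment is comparable to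
the dimension (`exists_card_goodWalks_le`).

*Positivity.* The spectral hypothesis on the kernel only sees the support of `μ`. The integral
operator is compact and self-adjoint, hence positive, and testing it against averages over small balls
shows that `K` is positive semidefinite when all positions lie in the support, which is almost sure
(`ae_posSemidef_gramMatrix`).

*Thresholding.* Let the spectral error be `E ≤ γ / 2`. Since `α K` is positive semidefinite with
trace at most `α n`, at most `2 α n / γ` eigenvalues of `A` reach the threshold `γ`, and in an
eigenbasis of `A` the squared Frobenius error is at most `3 γ α n` (`sum_sq_thresholded_sub_le`) while
the trace exceeds that of `α K` by at most a fraction `2 E / γ` (`sum_thresholded_le`). The trace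
correction and the rescaling cost lower order terms (`usvtKernel_error_le`). With `γ` of order
`(α n) ^ (3 / 4)` the total is of order `(α n) ^ (-1 / 8)` (`exists_threshold_constants`), which is
the condition `b / (α ε ^ 8) ≤ n`. Up to constants this implies the condition on `B`, because `α n` is
bounded below by `κ log 2`.
-/

/-! ### Closed walks and traces of powers -/

/-- The unordered pair of vertices joined by the `i`-th step of the walk
`u 0, u 1, …, u ℓ`. A step may stay in place, and the pair is then on the diagonal. -/
def stepEdge {V : Type*} {ℓ : ℕ} (u : Fin (ℓ + 1) → V) (i : Fin ℓ) : Sym2 V :=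
  s(u i.castSucc, u i.succ)

/-- The number of steps of the walk `u` along the edge `e`. -/
def edgeMult {V : Type*} [DecidableEq V] {ℓ : ℕ} (u : Fin (ℓ + 1) → V) (e : Sym2 V) : ℕ :=
  (Finset.univ.filter fun i => stepEdge u i = e).card

/-- The closed walks of length `ℓ` on the complete graph with loops on `V` that use no edge
exactly once. -/
def goodWalks (V : Type*) [Fintype V] [DecidableEq V] (ℓ : ℕ) : Finset (Fin (ℓ + 1) → V) :=
  Finset.univ.filter fun u => u 0 = u (Fin.last ℓ) ∧ ∀ e, edgeMult u e ≠ 1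

/-- The symmetric matrix whose entries are given by a function on unordered pairs. -/
def symMatrix {V : Type*} (z : Sym2 V → ℝ) : Matrix V V ℝ := Matrix.of fun i j => z s(i, j)

theorem symMatrix_isHermitian {V : Type*} (z : Sym2 V → ℝ) : (symMatrix z).IsHermitian := by
  ext i j
  simp [symMatrix, Sym2.eq_swap]

theorem matrix_pow_apply_eq_sum_walks {V : Type*} [Fintype V] [DecidableEq V]
    (M : Matrix V V ℝ) (ℓ : ℕ) (a b : V) :
    (M ^ ℓ) a b = ∑ u : Fin (ℓ + 1) → V,
      if u 0 = a ∧ u (Fin.last ℓ) = b then ∏ i : Fin ℓ, M (u i.castSucc) (u i.succ) else 0 := by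
  induction ℓ generalizing a with
  | zero =>
    rw [← (Equiv.funUnique (Fin 1) V).symm.sum_comp]
    simp only [pow_zero, Matrix.one_apply]
    by_cases hab : a = b
    · subst hab; simp
    · rw [if_neg hab, Finset.sum_eq_zero]
      intro x _
      rw [if_neg]
      rintro ⟨h1, h2⟩
      exact hab (h1.symm.trans h2)
  | succ ℓ ih =>
    rw [pow_succ', Matrix.mul_apply, ← (Fin.consEquiv fun _ : Fin (ℓ + 2) => V).sum_comp,
      Fintype.sum_prod_type]
    simp_rw [ih, Finset.mul_sum]
    rw [Finset.sum_comm]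
    conv_rhs => rw [Finset.sum_comm]
    refine Finset.sum_congr rfl fun v _ => ?_
    have hlast : ∀ x : V, (Fin.cons x v : Fin (ℓ + 2) → V) (Fin.last (ℓ + 1)) = v (Fin.last ℓ) :=
      fun x => by rw [← Fin.succ_last, Fin.cons_succ]
    simp only [Fin.consEquiv_apply, Fin.cons_zero, hlast, Fin.prod_univ_succ, Fin.castSucc_zero,
      Fin.cons_succ, ← Fin.succ_castSucc]
    by_cases hb : v (Fin.last ℓ) = b <;> simp [hb]

theorem trace_pow_eq_sum_walks {V : Type*} [Fintype V] [DecidableEq V]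
    (M : Matrix V V ℝ) (ℓ : ℕ) :
    (M ^ ℓ).trace = ∑ u : Fin (ℓ + 1) → V,
      if u 0 = u (Fin.last ℓ) then ∏ i : Fin ℓ, M (u i.castSucc) (u i.succ) else 0 := by
  simp only [Matrix.trace, Matrix.diag_apply, matrix_pow_apply_eq_sum_walks]
  rw [Finset.sum_comm]
  refine Finset.sum_congr rfl fun u _ => ?_
  rw [Finset.sum_eq_single (u 0)]
  · simp [eq_comm]
  · intro a _ ha
    simp [Ne.symm ha]
  · simp

theorem prod_stepEdge {V : Type*} [Fintype V] [DecidableEq V] {ℓ : ℕ} (z : Sym2 V → ℝ)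
    (u : Fin (ℓ + 1) → V) : ∏ i, z (stepEdge u i) = ∏ e, z e ^ edgeMult u e := by
  rw [← Finset.prod_fiberwise (s := Finset.univ) (g := stepEdge u)]
  refine Finset.prod_congr rfl fun e _ => ?_
  rw [edgeMult, ← Finset.prod_const]
  exact Finset.prod_congr rfl fun i hi => by rw [(Finset.mem_filter.1 hi).2]

theorem trace_symMatrix_pow {V : Type*} [Fintype V] [DecidableEq V] (z : Sym2 V → ℝ) (ℓ : ℕ) :
    (symMatrix z ^ ℓ).trace = ∑ u : Fin (ℓ + 1) → V,
      if u 0 = u (Fin.last ℓ) then ∏ e, z e ^ edgeMult u e else 0 := by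
  rw [trace_pow_eq_sum_walks]
  simp only [← prod_stepEdge]
  rfl

/-- The expectation of the trace of a power of a symmetric random matrix whose entries are
independent and take two values: `p e` is the law of the entry on the pair `e`, and `y e` its
values. -/
theorem sum_prod_mul_trace_symMatrix_pow {V : Type*} [Fintype V] [DecidableEq V]
    (p y : Sym2 V → Bool → ℝ) (ℓ : ℕ) :
    ∑ b : Sym2 V → Bool, (∏ e, p e (b e)) * (symMatrix (fun e => y e (b e)) ^ ℓ).trace =
      ∑ u : Fin (ℓ + 1) → V, if u 0 = u (Fin.last ℓ) then
        ∏ e, (∑ β, p e β * y e β ^ edgeMult u e) else 0 := by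
  simp_rw [trace_symMatrix_pow, Finset.mul_sum]
  rw [Finset.sum_comm]
  refine Finset.sum_congr rfl fun u _ => ?_
  split_ifs with h
  · rw [Finset.prod_univ_sum, Fintype.piFinset_univ]
    exact Finset.sum_congr rfl fun b _ => by rw [Finset.prod_mul_distrib]
  · simp

theorem sum_edgeMult {V : Type*} [Fintype V] [DecidableEq V] {ℓ : ℕ} (u : Fin (ℓ + 1) → V) :
    ∑ e, edgeMult u e = ℓ := by
  simp only [edgeMult]
  rw [← Finset.card_eq_sum_card_fiberwise (fun i _ => Finset.mem_coe.2 (Finset.mem_univ _))]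
  simp

theorem edgeMult_ne_zero_iff {V : Type*} [DecidableEq V] {ℓ : ℕ} (u : Fin (ℓ + 1) → V)
    (e : Sym2 V) : edgeMult u e ≠ 0 ↔ ∃ i, stepEdge u i = e := by
  simp [edgeMult, Finset.filter_eq_empty_iff]

/-- A walk is connected, so it visits at most one more vertex than it uses edges. -/
theorem card_image_le_card_edges {V : Type*} [DecidableEq V] {ℓ : ℕ} (u : Fin (ℓ + 1) → V) :
    (Finset.univ.image u).card ≤ (Finset.univ.image (stepEdge u)).card + 1 := by
  induction ℓ with
  | zero => simp
  | succ ℓ ih =>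
    specialize ih (u ∘ Fin.castSucc)
    have hV : Finset.univ.image u =
        insert (u (Fin.last _)) (Finset.univ.image (u ∘ Fin.castSucc)) := by
      ext x
      simp [Fin.exists_fin_succ', or_comm, eq_comm]
    have hE : Finset.univ.image (stepEdge u) =
        insert (stepEdge u (Fin.last _)) (Finset.univ.image (stepEdge (u ∘ Fin.castSucc))) := by
      ext x
      simp [Fin.exists_fin_succ', or_comm, eq_comm, stepEdge]
    by_cases hx : u (Fin.last _) ∈ Finset.univ.image (u ∘ Fin.castSucc)
    · rw [hV, Finset.insert_eq_of_mem hx, hE]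
      exact ih.trans (Nat.add_le_add_right (Finset.card_le_card (Finset.subset_insert _ _)) 1)
    · -- a step to a new vertex uses a new edge
      have hy : stepEdge u (Fin.last _) ∉ Finset.univ.image (stepEdge (u ∘ Fin.castSucc)) := by
        intro hy
        obtain ⟨i, -, hi⟩ := Finset.mem_image.1 hy
        have hmem : u (Fin.last _) ∈ stepEdge (u ∘ Fin.castSucc) i := by
          rw [hi, stepEdge, Fin.succ_last]
          exact Sym2.mem_mk_right _ _
        rcases Sym2.mem_iff.1 hmem with h | h
        · exact hx (Finset.mem_image.2 ⟨_, Finset.mem_univ _, h.symm⟩)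
        · exact hx (Finset.mem_image.2 ⟨_, Finset.mem_univ _, h.symm⟩)
      rw [hV, hE, Finset.card_insert_of_notMem hx, Finset.card_insert_of_notMem hy]
      omega

theorem card_edges_eq {V : Type*} [Fintype V] [DecidableEq V] {ℓ : ℕ} (u : Fin (ℓ + 1) → V) :
    (Finset.univ.image (stepEdge u)).card =
      (Finset.univ.filter fun e => edgeMult u e ≠ 0).card := by
  congr 1
  ext e
  simp [edgeMult_ne_zero_iff]

theorem two_mul_card_edges_le {V : Type*} [Fintype V] [DecidableEq V] {ℓ : ℕ}
    {u : Fin (ℓ + 1) → V} (hu : u ∈ goodWalks V ℓ) :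
    2 * (Finset.univ.filter fun e => edgeMult u e ≠ 0).card ≤ ℓ := by
  have hg := (Finset.mem_filter.1 hu).2.2
  calc 2 * (Finset.univ.filter fun e => edgeMult u e ≠ 0).card
      = ∑ e ∈ Finset.univ.filter fun e => edgeMult u e ≠ 0, 2 := by simp [mul_comm]
    _ ≤ ∑ e ∈ Finset.univ.filter fun e => edgeMult u e ≠ 0, edgeMult u e := by
        refine Finset.sum_le_sum fun e he => ?_
        have h0 := (Finset.mem_filter.1 he).2
        have h1 := hg e
        omega
    _ ≤ ∑ e, edgeMult u e := Finset.sum_le_sum_of_subset (Finset.filter_subset _ _)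
    _ = ℓ := sum_edgeMult u

/-- Let the entries be centred, with absolute moments of order at least two bounded by `α`. Then
only the walks that use no edge exactly once contribute to the expected trace, and a walk through
`m` vertices contributes at most `α ^ (m - 1)`. -/
theorem sum_prod_mul_trace_le {V : Type*} [Fintype V] [DecidableEq V]
    (p y : Sym2 V → Bool → ℝ) (ℓ : ℕ) {α : ℝ} (hα0 : 0 ≤ α) (hα1 : α ≤ 1)
    (h0 : ∀ e, ∑ β, p e β = 1) (h1 : ∀ e, ∑ β, p e β * y e β = 0)
    (h2 : ∀ e m, 2 ≤ m → |∑ β, p e β * y e β ^ m| ≤ α) :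
    ∑ b : Sym2 V → Bool, (∏ e, p e (b e)) * (symMatrix (fun e => y e (b e)) ^ ℓ).trace ≤
      ∑ u ∈ goodWalks V ℓ, α ^ ((Finset.univ.image u).card - 1) := by
  rw [sum_prod_mul_trace_symMatrix_pow, goodWalks, Finset.sum_filter]
  refine Finset.sum_le_sum fun u _ => ?_
  by_cases hc : u 0 = u (Fin.last ℓ)
  · simp only [hc, if_true, true_and]
    split_ifs with hg
    · refine (le_abs_self _).trans ?_
      rw [Finset.abs_prod]
      calc ∏ e, |∑ β, p e β * y e β ^ edgeMult u e|
          ≤ ∏ e, (if edgeMult u e ≠ 0 then α else 1) := by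
            refine Finset.prod_le_prod (fun _ _ => abs_nonneg _) fun e _ => ?_
            split_ifs with hm
            · exact h2 e _ (by have := hg e; omega)
            · rw [not_not] at hm
              simp only [hm, pow_zero, mul_one, h0 e, abs_one, le_refl]
        _ = α ^ (Finset.univ.filter fun e => edgeMult u e ≠ 0).card := by
            rw [← Finset.prod_filter, Finset.prod_const]
        _ ≤ α ^ ((Finset.univ.image u).card - 1) := by
            refine pow_le_pow_of_le_one hα0 hα1 ?_
            have := card_image_le_card_edges u
            rw [card_edges_eq] at this
            omega
    · push Not at hg
      obtain ⟨e, he⟩ := hg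
      refine (Finset.prod_eq_zero (Finset.mem_univ e) ?_).le
      simp only [he, pow_one, h1 e]
  · simp [hc]

/-- If all moments of the entries are nonnegative, and at least one from the second order on, then
the expected trace is at least the number of walks that use no edge exactly once. -/
theorem card_goodWalks_le {V : Type*} [Fintype V] [DecidableEq V]
    (p y : Sym2 V → Bool → ℝ) (ℓ : ℕ) (h0 : ∀ e, ∑ β, p e β = 1)
    (h1 : ∀ e, ∑ β, p e β * y e β = 0)
    (h2 : ∀ e m, 2 ≤ m → 1 ≤ ∑ β, p e β * y e β ^ m) :
    ((goodWalks V ℓ).card : ℝ) ≤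
      ∑ b : Sym2 V → Bool, (∏ e, p e (b e)) * (symMatrix (fun e => y e (b e)) ^ ℓ).trace := by
  rw [sum_prod_mul_trace_symMatrix_pow, Finset.card_eq_sum_ones, Nat.cast_sum, goodWalks,
    Finset.sum_filter]
  refine Finset.sum_le_sum fun u _ => ?_
  by_cases hc : u 0 = u (Fin.last ℓ)
  · simp only [hc, if_true, true_and]
    split_ifs with hg
    · rw [Nat.cast_one]
      rw [← Finset.prod_const_one (s := (Finset.univ : Finset (Sym2 V)))]
      refine Finset.prod_le_prod (fun _ _ => zero_le_one) fun e _ => ?_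
      have := hg e
      rcases Nat.lt_or_ge (edgeMult u e) 2 with hm | hm
      · have hm : edgeMult u e = 0 := by omega
        simp only [hm, pow_zero, mul_one, h0 e, le_refl]
      · exact h2 e _ hm
    · push Not at hg
      obtain ⟨e, he⟩ := hg
      refine (Finset.prod_eq_zero (Finset.mem_univ e) ?_).ge
      simp only [he, pow_one, h1 e]
  · simp [hc]

/-! ### Comparing walks on vertex sets of different sizes -/

/-- The walks of `goodWalks` that visit exactly `m` vertices. -/
def goodWalksCard (V : Type*) [Fintype V] [DecidableEq V] (ℓ m : ℕ) : Finset (Fin (ℓ + 1) → V) :=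
  (goodWalks V ℓ).filter fun u => (Finset.univ.image u).card = m

theorem comp_mem_goodWalks {V V' : Type*} [Fintype V] [DecidableEq V] [Fintype V'] [DecidableEq V']
    {ℓ : ℕ} {u : Fin (ℓ + 1) → V} (hu : u ∈ goodWalks V ℓ) {f : V → V'}
    (hf : Set.InjOn f (Set.range u)) : f ∘ u ∈ goodWalks V' ℓ := by
  obtain ⟨-, hc, hg⟩ := Finset.mem_filter.1 hu
  refine Finset.mem_filter.2 ⟨Finset.mem_univ _, congrArg f hc, fun e he => ?_⟩
  obtain ⟨i, hi⟩ := (edgeMult_ne_zero_iff (f ∘ u) e).1 (by omega)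
  refine hg (stepEdge u i) ?_
  rw [← he, ← hi]
  refine congrArg Finset.card (Finset.filter_congr fun j _ => ?_)
  have hmap : ∀ j, stepEdge (f ∘ u) j = Sym2.map f (stepEdge u j) := fun j => rfl
  refine ⟨fun h => by rw [hmap, hmap, h], fun h => ?_⟩
  simp only [stepEdge, Function.comp, Sym2.eq_iff] at h ⊢
  have inj : ∀ a b, f (u a) = f (u b) → u a = u b := fun a b h => hf ⟨a, rfl⟩ ⟨b, rfl⟩ h
  rcases h with ⟨h, h'⟩ | ⟨h, h'⟩
  · exact Or.inl ⟨inj _ _ h, inj _ _ h'⟩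
  · exact Or.inr ⟨inj _ _ h, inj _ _ h'⟩

theorem card_goodWalks_image_le {V V' : Type*} [Fintype V] [DecidableEq V] [Fintype V']
    [DecidableEq V'] (ℓ : ℕ) {T : Finset V} {T' : Finset V'} (h : T.card = T'.card) :
    ((goodWalks V ℓ).filter fun u => Finset.univ.image u = T).card ≤
      ((goodWalks V' ℓ).filter fun u => Finset.univ.image u = T').card := by
  classical
  rcases T.eq_empty_or_nonempty with rfl | ⟨t, ht⟩
  · rw [Finset.filter_false_of_mem]
    · simp
    · intro u _ hu
      exact (Finset.univ_nonempty.image u).ne_empty hu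
  have hne : T'.Nonempty := by
    rw [← Finset.card_pos, ← h]
    exact Finset.card_pos.2 ⟨t, ht⟩
  obtain ⟨t', ht'⟩ := hne
  let φ : T ≃ T' := Finset.equivOfCardEq h
  let f : V → V' := fun v => if hv : v ∈ T then (φ ⟨v, hv⟩ : V') else t'
  have hfT : ∀ v (hv : v ∈ T), f v = φ ⟨v, hv⟩ := fun v hv => dif_pos hv
  have hinj : Set.InjOn f T := by
    intro a ha b hb hab
    rw [hfT a ha, hfT b hb] at hab
    exact congrArg Subtype.val (φ.injective (Subtype.ext hab))
  have himg : T.image f = T' := by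
    ext w
    constructor
    · intro hw
      obtain ⟨v, hv, rfl⟩ := Finset.mem_image.1 hw
      rw [hfT v hv]
      exact (φ ⟨v, hv⟩).2
    · intro hw
      refine Finset.mem_image.2 ⟨φ.symm ⟨w, hw⟩, (φ.symm ⟨w, hw⟩).2, ?_⟩
      rw [hfT _ (φ.symm ⟨w, hw⟩).2]
      simp
  have hrange : ∀ u : Fin (ℓ + 1) → V, Finset.univ.image u = T → Set.range u = T := by
    intro u hu
    rw [← hu]
    simp
  refine Finset.card_le_card_of_injOn (fun u => f ∘ u) ?_ ?_
  · intro u hu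
    obtain ⟨hu1, hu2⟩ := Finset.mem_filter.1 (Finset.mem_coe.1 hu)
    refine Finset.mem_coe.2 (Finset.mem_filter.2 ⟨comp_mem_goodWalks hu1 ?_, ?_⟩)
    · rw [hrange u hu2]
      exact hinj
    · rw [← Finset.image_image, hu2, himg]
  · intro u hu v hv huv
    have hu2 := hrange u (Finset.mem_filter.1 (Finset.mem_coe.1 hu)).2
    have hv2 := hrange v (Finset.mem_filter.1 (Finset.mem_coe.1 hv)).2
    funext i
    refine hinj ?_ ?_ (congrFun huv i)
    · rw [← hu2]; exact ⟨i, rfl⟩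
    · rw [← hv2]; exact ⟨i, rfl⟩

theorem card_goodWalksCard_eq {V : Type*} [Fintype V] [DecidableEq V] (ℓ m : ℕ) :
    (goodWalksCard V ℓ m).card = ∑ T ∈ (Finset.univ : Finset V).powersetCard m,
      ((goodWalks V ℓ).filter fun u => Finset.univ.image u = T).card := by
  rw [Finset.card_eq_sum_card_fiberwise (t := (Finset.univ : Finset V).powersetCard m)
    (f := fun u => Finset.univ.image u)]
  · refine Finset.sum_congr rfl fun T hT => ?_
    rw [goodWalksCard, Finset.filter_filter]
    refine congrArg Finset.card (Finset.filter_congr fun u _ => ?_)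
    have := (Finset.mem_powersetCard.1 hT).2
    refine ⟨fun h => h.2, fun h => ⟨?_, h⟩⟩
    rw [h, this]
  · intro u hu
    have := (Finset.mem_filter.1 (Finset.mem_coe.1 hu)).2
    exact Finset.mem_coe.2 (Finset.mem_powersetCard.2 ⟨Finset.subset_univ _, this⟩)

/-- The number of walks through `m` vertices is proportional to the number of ways to choose the
`m` vertices. -/
theorem card_goodWalksCard_mul_choose_le (V V' : Type*) [Fintype V] [DecidableEq V] [Fintype V']
    [DecidableEq V'] (ℓ m : ℕ) :
    (goodWalksCard V ℓ m).card * (Fintype.card V').choose m ≤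
      (Fintype.card V).choose m * (goodWalksCard V' ℓ m).card := by
  rw [card_goodWalksCard_eq, card_goodWalksCard_eq, ← Finset.card_univ, ← Finset.card_univ,
    ← Finset.card_powersetCard, ← Finset.card_powersetCard, Finset.card_eq_sum_ones,
    Finset.card_eq_sum_ones, Finset.sum_mul_sum, Finset.sum_mul_sum]
  refine Finset.sum_le_sum fun T hT => Finset.sum_le_sum fun T' hT' => ?_
  rw [mul_one, one_mul]
  exact card_goodWalks_image_le ℓ
    ((Finset.mem_powersetCard.1 hT).2.trans (Finset.mem_powersetCard.1 hT').2.symm)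

theorem card_goodWalksCard_mul_pow_le (n k m : ℕ) (hm : m ≤ k + 1) :
    (goodWalksCard (Fin n) (2 * k) m).card * k ^ m ≤
      n ^ m * (goodWalksCard (Fin (2 * k)) (2 * k) m).card := by
  have h := card_goodWalksCard_mul_choose_le (Fin n) (Fin (2 * k)) (2 * k) m
  rw [Fintype.card_fin, Fintype.card_fin] at h
  have hk : k ^ m ≤ (2 * k).descFactorial m :=
    (Nat.pow_le_pow_left (by omega) m).trans (Nat.pow_sub_le_descFactorial (2 * k) m)
  have hn : n.descFactorial m ≤ n ^ m := Nat.descFactorial_le_pow n m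
  rw [Nat.descFactorial_eq_factorial_mul_choose] at hk hn
  calc (goodWalksCard (Fin n) (2 * k) m).card * k ^ m
      ≤ (goodWalksCard (Fin n) (2 * k) m).card * (m.factorial * (2 * k).choose m) :=
        Nat.mul_le_mul_left _ hk
    _ = m.factorial * ((goodWalksCard (Fin n) (2 * k) m).card * (2 * k).choose m) := by ring
    _ ≤ m.factorial * (n.choose m * (goodWalksCard (Fin (2 * k)) (2 * k) m).card) :=
        Nat.mul_le_mul_left _ h
    _ = (m.factorial * n.choose m) * (goodWalksCard (Fin (2 * k)) (2 * k) m).card := by ring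
    _ ≤ _ := Nat.mul_le_mul_right _ hn

/-- The weighted number of walks on `n` vertices is controlled by the number of walks on `2 k`
vertices, as soon as `α n ≤ k`: a walk that uses each of its edges twice visits at most `k + 1`
vertices, and each of them after the first has `n` possible positions, at cost `α`, against at least
`k` positions among the `2 k` vertices. -/
theorem sum_goodWalks_le {n k : ℕ} (hk : 0 < k) {α : ℝ} (hα : 0 ≤ α) (hαn : α * n ≤ k) :
    ∑ u ∈ goodWalks (Fin n) (2 * k), α ^ ((Finset.univ.image u).card - 1) ≤
      n * ((goodWalks (Fin (2 * k)) (2 * k)).card : ℝ) := by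
  have hmaps : ∀ N, ∀ u ∈ goodWalks (Fin N) (2 * k),
      (Finset.univ.image u).card ∈ Finset.Icc 1 (k + 1) := by
    intro N u hu
    have h1 := card_image_le_card_edges u
    have h2 := two_mul_card_edges_le hu
    rw [card_edges_eq] at h1
    have h3 : 0 < (Finset.univ.image u).card :=
      Finset.card_pos.2 (Finset.univ_nonempty.image u)
    exact Finset.mem_Icc.2 ⟨h3, by omega⟩
  rw [← Finset.sum_fiberwise_of_maps_to (hmaps n),
    Finset.card_eq_sum_card_fiberwise (fun u hu => hmaps (2 * k) u hu), Nat.cast_sum,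
    Finset.mul_sum]
  refine Finset.sum_le_sum fun m hm => ?_
  obtain ⟨hm1, hm2⟩ := Finset.mem_Icc.1 hm
  have hk' : (0 : ℝ) < k := by exact_mod_cast hk
  have hkm : (1 : ℝ) ≤ k := by exact_mod_cast hk
  have key : ((goodWalksCard (Fin n) (2 * k) m).card : ℝ) * (k : ℝ) ^ m ≤
      (n : ℝ) ^ m * ((goodWalksCard (Fin (2 * k)) (2 * k) m).card : ℝ) := by
    exact_mod_cast card_goodWalksCard_mul_pow_le n k m hm2
  have hsum : ∑ u ∈ (goodWalks (Fin n) (2 * k)).filter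
      (fun u => (Finset.univ.image u).card = m), α ^ ((Finset.univ.image u).card - 1) =
      ((goodWalksCard (Fin n) (2 * k) m).card : ℝ) * α ^ (m - 1) := by
    rw [goodWalksCard, ← nsmul_eq_mul, ← Finset.sum_const]
    exact Finset.sum_congr rfl fun u hu => by rw [(Finset.mem_filter.1 hu).2]
  rw [hsum]
  obtain ⟨j, rfl⟩ : ∃ j, m = j + 1 := ⟨m - 1, by omega⟩
  rw [Nat.add_sub_cancel]
  set N := ((goodWalksCard (Fin n) (2 * k) (j + 1)).card : ℝ)
  set N' := ((goodWalksCard (Fin (2 * k)) (2 * k) (j + 1)).card : ℝ) with hN'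
  have hN0 : 0 ≤ N' := Nat.cast_nonneg _
  refine le_of_mul_le_mul_right ?_ (pow_pos hk' (j + 1))
  calc N * α ^ j * (k : ℝ) ^ (j + 1) = α ^ j * (N * (k : ℝ) ^ (j + 1)) := by ring
    _ ≤ α ^ j * ((n : ℝ) ^ (j + 1) * N') := mul_le_mul_of_nonneg_left key (pow_nonneg hα j)
    _ = (α * n) ^ j * (n * N') := by ring
    _ ≤ (k : ℝ) ^ j * (n * N') :=
        mul_le_mul_of_nonneg_right (pow_le_pow_left₀ (by positivity) hαn j) (by positivity)
    _ ≤ (k : ℝ) ^ (j + 1) * (n * N') :=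
        mul_le_mul_of_nonneg_right (pow_le_pow_right₀ hkm (Nat.le_succ j)) (by positivity)
    _ = n * N' * (k : ℝ) ^ (j + 1) := by ring

/-! ### Orthogonal diagonalization of real symmetric matrices -/

section Diagonalization

variable {V : Type*} [Fintype V] [DecidableEq V] {M : Matrix V V ℝ}

/-- The orthogonal matrix whose columns are the eigenvectors chosen by Mathlib for a real symmetric
matrix. -/
noncomputable def eigenMatrix (hM : M.IsHermitian) : Matrix V V ℝ :=
  (hM.eigenvectorUnitary : Matrix V V ℝ)

theorem eigenMatrix_transpose_mul_self (hM : M.IsHermitian) :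
    (eigenMatrix hM).transpose * eigenMatrix hM = 1 := by
  have := Unitary.coe_star_mul_self hM.eigenvectorUnitary
  rwa [Matrix.star_eq_conjTranspose, Matrix.conjTranspose_eq_transpose_of_trivial] at this

theorem eigenMatrix_mul_transpose_self (hM : M.IsHermitian) :
    eigenMatrix hM * (eigenMatrix hM).transpose = 1 :=
  mul_eq_one_comm.1 (eigenMatrix_transpose_mul_self hM)

theorem eq_eigenMatrix_mul (hM : M.IsHermitian) :
    M = eigenMatrix hM * Matrix.diagonal hM.eigenvalues * (eigenMatrix hM).transpose := by
  conv_lhs => rw [hM.spectral_theorem]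
  rw [Unitary.conjStarAlgAut_apply, Matrix.star_eq_conjTranspose,
    Matrix.conjTranspose_eq_transpose_of_trivial]
  rfl

theorem pow_eq_eigenMatrix_mul (hM : M.IsHermitian) (p : ℕ) :
    M ^ p = eigenMatrix hM * Matrix.diagonal (fun i => hM.eigenvalues i ^ p) *
      (eigenMatrix hM).transpose := by
  induction p with
  | zero => simp [eigenMatrix_mul_transpose_self]
  | succ p ih =>
    have h := eigenMatrix_transpose_mul_self hM
    set U := eigenMatrix hM
    calc M ^ (p + 1) = M ^ p * (U * Matrix.diagonal hM.eigenvalues * U.transpose) := by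
          rw [pow_succ]
          exact congrArg (M ^ p * ·) (eq_eigenMatrix_mul hM)
      _ = U * Matrix.diagonal (fun i => hM.eigenvalues i ^ p) * (U.transpose * U) *
            Matrix.diagonal hM.eigenvalues * U.transpose := by
          rw [ih]
          simp only [Matrix.mul_assoc]
      _ = U * Matrix.diagonal (fun i => hM.eigenvalues i ^ (p + 1)) * U.transpose := by
          rw [h, Matrix.mul_one, Matrix.mul_assoc U, Matrix.diagonal_mul_diagonal]
          simp only [pow_succ]

theorem trace_pow_eq_sum_eigenvalues_pow (hM : M.IsHermitian) (p : ℕ) :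
    (M ^ p).trace = ∑ i, hM.eigenvalues i ^ p := by
  rw [pow_eq_eigenMatrix_mul, Matrix.trace_mul_cycle, eigenMatrix_transpose_mul_self,
    Matrix.one_mul, Matrix.trace_diagonal]

theorem sum_sq_transpose_mulVec {U : Matrix V V ℝ} (hU : U * U.transpose = 1) (x : V → ℝ) :
    ∑ i, (U.transpose.mulVec x) i ^ 2 = ∑ i, x i ^ 2 := by
  have h : U.transpose.mulVec x ⬝ᵥ U.transpose.mulVec x = x ⬝ᵥ x := by
    rw [Matrix.dotProduct_mulVec, Matrix.vecMul_transpose, Matrix.mulVec_mulVec, hU,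
      Matrix.one_mulVec]
  simpa [dotProduct, sq] using h

theorem dotProduct_mulVec_eq_sum_eigenvalues (hM : M.IsHermitian) (x : V → ℝ) :
    x ⬝ᵥ M.mulVec x =
      ∑ i, hM.eigenvalues i * ((eigenMatrix hM).transpose.mulVec x) i ^ 2 := by
  conv_lhs => rw [eq_eigenMatrix_mul hM]
  rw [← Matrix.mulVec_mulVec, ← Matrix.mulVec_mulVec, Matrix.dotProduct_mulVec,
    ← Matrix.mulVec_transpose, dotProduct]
  refine Finset.sum_congr rfl fun i _ => ?_
  rw [Matrix.mulVec_diagonal]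
  ring

theorem abs_dotProduct_mulVec_le (hM : M.IsHermitian) {L : ℝ}
    (hL : ∀ i, |hM.eigenvalues i| ≤ L) (x : V → ℝ) :
    |x ⬝ᵥ M.mulVec x| ≤ L * ∑ i, x i ^ 2 := by
  rw [dotProduct_mulVec_eq_sum_eigenvalues hM,
    ← sum_sq_transpose_mulVec (eigenMatrix_mul_transpose_self hM) x, Finset.mul_sum]
  refine (Finset.abs_sum_le_sum_abs _ _).trans (Finset.sum_le_sum fun i _ => ?_)
  rw [abs_mul, abs_of_nonneg (sq_nonneg ((eigenMatrix hM).transpose.mulVec x i))]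
  exact mul_le_mul_of_nonneg_right (hL i) (sq_nonneg _)

theorem sum_sq_eigenvectorBasis (hM : M.IsHermitian) (i : V) :
    ∑ j, hM.eigenvectorBasis i j ^ 2 = 1 := by
  have h := hM.eigenvectorBasis.orthonormal.1 i
  rw [EuclideanSpace.norm_eq, Real.sqrt_eq_one] at h
  simpa using h

end Diagonalization

/-! ### A net argument with integer vectors -/

/-- The integer vectors of length at most `√(32 r)`. Rescaled by `4 √r`, they form a net of the
unit sphere of `ℝ^r`, whose cardinality is exponential in `r`. -/
noncomputable def integerNet (r : ℕ) : Finset (Fin r → ℤ) :=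
  (Fintype.piFinset fun _ : Fin r => Finset.Icc (-(32 * r : ℤ)) (32 * r)).filter
    fun z => ∑ i, z i ^ 2 ≤ 32 * r

theorem mem_integerNet {r : ℕ} {z : Fin r → ℤ} (hz : ∑ i, z i ^ 2 ≤ 32 * (r : ℤ)) :
    z ∈ integerNet r := by
  refine Finset.mem_filter.2 ⟨Fintype.mem_piFinset.2 fun i => ?_, hz⟩
  have h1 : z i ^ 2 ≤ 32 * (r : ℤ) :=
    (Finset.single_le_sum (f := fun i => z i ^ 2) (fun _ _ => sq_nonneg _)
      (Finset.mem_univ i)).trans hz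
  have h2 : |z i| ≤ z i ^ 2 := by
    rw [← sq_abs]
    exact Int.le_self_sq _
  exact Finset.mem_Icc.2 (abs_le.1 (h2.trans h1))

theorem sum_Icc_half_pow_natAbs_le (m : ℕ) :
    ∑ z ∈ Finset.Icc (-(m : ℤ)) m, (1 / 2 : ℝ) ^ z.natAbs ≤ 3 - 2 * (1 / 2 : ℝ) ^ m := by
  induction m with
  | zero => norm_num
  | succ m ih =>
    have h : Finset.Icc (-((m + 1 : ℕ) : ℤ)) (m + 1 : ℕ) =
        insert (-((m : ℤ) + 1)) (insert ((m : ℤ) + 1) (Finset.Icc (-(m : ℤ)) m)) := by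
      ext z
      simp only [Finset.mem_Icc, Finset.mem_insert]
      push_cast
      omega
    have e1 : (-((m : ℤ) + 1)).natAbs = m + 1 := by omega
    have e2 : ((m : ℤ) + 1).natAbs = m + 1 := by omega
    rw [h, Finset.sum_insert, Finset.sum_insert, e1, e2]
    · rw [pow_succ]
      linarith
    · simp
    · simp only [Finset.mem_insert, Finset.mem_Icc]
      omega

theorem card_integerNet_le (r : ℕ) : ((integerNet r).card : ℝ) ≤ (2 ^ 32 * 3) ^ r := by
  have h1 : ∀ z ∈ integerNet r, (1 : ℝ) ≤ 2 ^ (32 * r) * ∏ i, (1 / 2 : ℝ) ^ (z i).natAbs := by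
    intro z hz
    have hz := (Finset.mem_filter.1 hz).2
    have h2 : ∑ i, (z i).natAbs ≤ 32 * r := by
      zify
      refine (Finset.sum_le_sum fun i _ => ?_).trans hz
      rw [← sq_abs]
      exact Int.le_self_sq _
    rw [Finset.prod_pow_eq_pow_sum, one_div, inv_pow, ← div_eq_mul_inv, one_le_div (by positivity)]
    exact pow_le_pow_right₀ (by norm_num) h2
  calc ((integerNet r).card : ℝ) = ∑ z ∈ integerNet r, (1 : ℝ) := by simp
    _ ≤ ∑ z ∈ integerNet r, 2 ^ (32 * r) * ∏ i, (1 / 2 : ℝ) ^ (z i).natAbs :=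
        Finset.sum_le_sum h1
    _ ≤ ∑ z ∈ Fintype.piFinset fun _ : Fin r => Finset.Icc (-(32 * r : ℤ)) (32 * r),
          2 ^ (32 * r) * ∏ i, (1 / 2 : ℝ) ^ (z i).natAbs :=
        Finset.sum_le_sum_of_subset_of_nonneg (Finset.filter_subset _ _)
          fun _ _ _ => by positivity
    _ = 2 ^ (32 * r) * ∏ _i : Fin r, ∑ z ∈ Finset.Icc (-(32 * r : ℤ)) (32 * r),
          (1 / 2 : ℝ) ^ z.natAbs := by
        rw [← Finset.mul_sum, Finset.prod_univ_sum]
    _ ≤ 2 ^ (32 * r) * ∏ _i : Fin r, (3 : ℝ) := by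
        gcongr with i
        have h := sum_Icc_half_pow_natAbs_le (32 * r)
        push_cast at h
        have : (0 : ℝ) ≤ (1 / 2) ^ (32 * r) := by positivity
        linarith
    _ = (2 ^ 32 * 3) ^ r := by
        rw [Finset.prod_const, Finset.card_univ, Fintype.card_fin, mul_pow, ← pow_mul]

/-- The quadratic form of a symmetric matrix of spectral radius `|λ|` is at least `8 r |λ|` in
absolute value at the integer vector nearest to `4 √r` times an eigenvector of `λ`. -/
theorem exists_mem_integerNet {r : ℕ} {M : Matrix (Fin r) (Fin r) ℝ} (hM : M.IsHermitian)
    (i : Fin r) (hi : ∀ j, |hM.eigenvalues j| ≤ |hM.eigenvalues i|) :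
    ∃ z ∈ integerNet r, 8 * r * |hM.eigenvalues i| ≤
      |(fun j => (z j : ℝ)) ⬝ᵥ M.mulVec (fun j => (z j : ℝ))| := by
  set l := hM.eigenvalues i with hl
  set v : Fin r → ℝ := ⇑(hM.eigenvectorBasis i) with hv
  have hvv : ∑ j, v j ^ 2 = 1 := sum_sq_eigenvectorBasis hM i
  have hMv : M.mulVec v = l • v := hM.mulVec_eigenvectorBasis i
  set R := Real.sqrt r with hR
  have hR0 : 0 ≤ R := Real.sqrt_nonneg _
  have hRR : R ^ 2 = r := Real.sq_sqrt (Nat.cast_nonneg r)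
  let z : Fin r → ℤ := fun j => round (4 * R * v j)
  set y : Fin r → ℝ := fun j => z j - 4 * R * v j with hy
  have hyj : ∀ j, y j ^ 2 ≤ 1 / 4 := by
    intro j
    have h := abs_sub_round (4 * R * v j)
    rw [abs_sub_comm] at h
    have := sq_le_sq' (neg_le_of_abs_le h) (le_of_abs_le h)
    calc y j ^ 2 ≤ (1 / 2) ^ 2 := this
      _ = 1 / 4 := by norm_num
  have hyy : ∑ j, y j ^ 2 ≤ r / 4 := by
    refine (Finset.sum_le_sum fun j _ => hyj j).trans ?_
    simp only [Finset.sum_const, Finset.card_univ, Fintype.card_fin, nsmul_eq_mul]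
    linarith
  have hyv : |∑ j, y j * v j| ≤ R / 2 := by
    refine abs_le_of_sq_le_sq ?_ (by positivity)
    refine (Finset.sum_mul_sq_le_sq_mul_sq _ _ _).trans ?_
    rw [hvv, mul_one, div_pow, hRR]
    linarith
  have hzy : (fun j => (z j : ℝ)) = (4 * R) • v + y := by
    funext j
    simp [hy]
  have hz2 : ∑ j, (z j : ℝ) ^ 2 ≤ 32 * r := by
    have h1 : ∑ j, (z j : ℝ) ^ 2 =
        16 * R ^ 2 * ∑ j, v j ^ 2 + 8 * R * ∑ j, y j * v j + ∑ j, y j ^ 2 := by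
      rw [Finset.mul_sum, Finset.mul_sum, ← Finset.sum_add_distrib, ← Finset.sum_add_distrib]
      refine Finset.sum_congr rfl fun j _ => ?_
      simp only [hy]
      ring
    have h2 : 8 * R * ∑ j, y j * v j ≤ 8 * R * (R / 2) :=
      mul_le_mul_of_nonneg_left (le_of_abs_le hyv) (by positivity)
    rw [h1, hvv]
    have : (0 : ℝ) ≤ r := Nat.cast_nonneg r
    nlinarith
  refine ⟨z, mem_integerNet (by exact_mod_cast hz2), ?_⟩
  have hsymm : v ⬝ᵥ M.mulVec y = l * ∑ j, y j * v j := by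
    rw [Matrix.dotProduct_mulVec, ← Matrix.mulVec_transpose,
      show M.transpose = M by simpa [Matrix.IsHermitian] using hM, hMv, smul_dotProduct,
      smul_eq_mul, dotProduct_comm]
    rfl
  have hq : (fun j => (z j : ℝ)) ⬝ᵥ M.mulVec (fun j => (z j : ℝ)) =
      16 * r * l + 8 * R * l * (∑ j, y j * v j) + y ⬝ᵥ M.mulVec y := by
    have hvv' : v ⬝ᵥ v = 1 := by rw [← hvv]; simp [dotProduct, sq]
    have hyv' : y ⬝ᵥ v = ∑ j, y j * v j := rfl
    rw [hzy, Matrix.mulVec_add, Matrix.mulVec_smul, add_dotProduct, dotProduct_add,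
      dotProduct_add, smul_dotProduct, smul_dotProduct, dotProduct_smul, dotProduct_smul, hsymm,
      hMv, dotProduct_smul, dotProduct_smul, hvv', hyv', ← hRR]
    simp only [smul_eq_mul]
    ring
  have hqy : |y ⬝ᵥ M.mulVec y| ≤ |l| * (r / 4) :=
    (abs_dotProduct_mulVec_le hM hi y).trans (mul_le_mul_of_nonneg_left hyy (abs_nonneg _))
  have hc : |8 * R * l * (∑ j, y j * v j)| ≤ 4 * r * |l| := by
    rw [abs_mul, abs_mul, abs_of_nonneg (by positivity : 0 ≤ 8 * R)]
    calc 8 * R * |l| * |∑ j, y j * v j| ≤ 8 * R * |l| * (R / 2) :=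
          mul_le_mul_of_nonneg_left hyv (by positivity)
      _ = 4 * R ^ 2 * |l| := by ring
      _ = _ := by rw [hRR]
  have hmain : |16 * (r : ℝ) * l| = 16 * r * |l| := by
    rw [abs_mul, abs_of_nonneg (by positivity : (0 : ℝ) ≤ 16 * r)]
  rw [hq]
  have h1 := abs_sub_abs_le_abs_sub (16 * (r : ℝ) * l)
    (-(8 * R * l * (∑ j, y j * v j) + y ⬝ᵥ M.mulVec y))
  have h2 := abs_add_le (8 * R * l * (∑ j, y j * v j)) (y ⬝ᵥ M.mulVec y)
  rw [abs_neg, sub_neg_eq_add, ← add_assoc, hmain] at h1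
  have h3 : 0 ≤ (r : ℝ) * |l| := by positivity
  linarith

/-- The trace of an even power is controlled by the values of the quadratic form on the net. -/
theorem trace_pow_le_sum_integerNet {r : ℕ} (hr : 0 < r) {M : Matrix (Fin r) (Fin r) ℝ}
    (hM : M.IsHermitian) (k : ℕ) :
    (M ^ (2 * k)).trace ≤ r * ∑ z ∈ integerNet r,
      (((fun j => (z j : ℝ)) ⬝ᵥ M.mulVec fun j => (z j : ℝ)) / (8 * r)) ^ (2 * k) := by
  have hr' : (0 : ℝ) < r := by exact_mod_cast hr
  have : Nonempty (Fin r) := ⟨⟨0, hr⟩⟩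
  obtain ⟨i, -, hi⟩ := Finset.exists_max_image Finset.univ (fun j => |hM.eigenvalues j|)
    Finset.univ_nonempty
  obtain ⟨z, hz, hzi⟩ := exists_mem_integerNet hM i fun j => hi j (Finset.mem_univ j)
  have hmax : hM.eigenvalues i ^ (2 * k) ≤ ∑ z ∈ integerNet r,
      (((fun j => (z j : ℝ)) ⬝ᵥ M.mulVec fun j => (z j : ℝ)) / (8 * r)) ^ (2 * k) := by
    refine le_trans ?_ (Finset.single_le_sum (fun z _ => (even_two_mul k).pow_nonneg _) hz)
    rw [← (even_two_mul k).pow_abs, ← (even_two_mul k).pow_abs (_ / _)]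
    refine pow_le_pow_left₀ (abs_nonneg _) ?_ _
    rw [abs_div, abs_of_pos (by positivity : (0 : ℝ) < 8 * r), le_div_iff₀ (by positivity)]
    linarith
  rw [trace_pow_eq_sum_eigenvalues_pow hM]
  calc ∑ j, hM.eigenvalues j ^ (2 * k) ≤ ∑ _j : Fin r, hM.eigenvalues i ^ (2 * k) := by
        refine Finset.sum_le_sum fun j _ => ?_
        rw [← (even_two_mul k).pow_abs, ← (even_two_mul k).pow_abs (hM.eigenvalues i)]
        exact pow_le_pow_left₀ (abs_nonneg _) (hi j (Finset.mem_univ j)) _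
    _ = r * hM.eigenvalues i ^ (2 * k) := by simp
    _ ≤ _ := mul_le_mul_of_nonneg_left hmax hr'.le

/-! ### Counting walks with a two-valued random matrix -/

theorem exp_le_add_exp_sq (x : ℝ) : Real.exp x ≤ x + Real.exp (x ^ 2) := by
  have h1 := Real.add_one_le_exp (x ^ 2)
  rcases le_or_gt |x| 1 with h | h
  · have := (abs_le.1 (Real.abs_exp_sub_one_sub_id_le h)).2
    linarith
  rcases lt_abs.1 h with h | h
  · have : Real.exp x ≤ Real.exp (x ^ 2) := Real.exp_le_exp.2 (by nlinarith)
    linarith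
  · have : Real.exp x ≤ 1 := Real.exp_le_one_iff.2 (by linarith)
    nlinarith

/-- The law of the entries of the comparison matrix. -/
noncomputable def skewWeight (β : Bool) : ℝ := if β then 1 / 3 else 2 / 3

/-- The values of the entries of the comparison matrix. They are centred, and their higher moments
`(2 ^ m + 2 (-1) ^ m) / 3` are all at least one, which a symmetric law would not allow. -/
def skewValue (β : Bool) : ℝ := if β then 2 else -1

theorem skewWeight_nonneg (β : Bool) : 0 ≤ skewWeight β := by
  cases β <;> norm_num [skewWeight]

theorem sum_skewWeight : ∑ β, skewWeight β = 1 := by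
  norm_num [skewWeight]

theorem sum_skewWeight_mul_skewValue : ∑ β, skewWeight β * skewValue β = 0 := by
  norm_num [skewWeight, skewValue]

theorem one_le_sum_skewWeight_mul_pow {m : ℕ} (hm : 2 ≤ m) :
    1 ≤ ∑ β, skewWeight β * skewValue β ^ m := by
  have h : ∑ β, skewWeight β * skewValue β ^ m = 1 / 3 * 2 ^ m + 2 / 3 * (-1) ^ m := by
    simp [skewWeight, skewValue]
  rw [h]
  rcases Nat.lt_or_ge m 3 with h3 | h3
  · have : m = 2 := by omega
    subst this
    norm_num
  · have h8 : (2 : ℝ) ^ 3 ≤ 2 ^ m := pow_le_pow_right₀ (by norm_num) h3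
    rcases neg_one_pow_eq_or ℝ m with h1 | h1 <;> rw [h1] <;> linarith

theorem sum_skewWeight_mul_exp_le (t : ℝ) :
    ∑ β, skewWeight β * Real.exp (t * skewValue β) ≤ Real.exp (4 * t ^ 2) := by
  have hβ : ∀ β, skewWeight β * Real.exp (t * skewValue β) ≤
      t * (skewWeight β * skewValue β) + skewWeight β * Real.exp (4 * t ^ 2) := by
    intro β
    have h1 := exp_le_add_exp_sq (t * skewValue β)
    have h2 : Real.exp ((t * skewValue β) ^ 2) ≤ Real.exp (4 * t ^ 2) := by
      refine Real.exp_le_exp.2 ?_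
      cases β <;> norm_num [skewValue] <;> nlinarith [sq_nonneg t]
    calc skewWeight β * Real.exp (t * skewValue β)
        ≤ skewWeight β * (t * skewValue β + Real.exp (4 * t ^ 2)) :=
          mul_le_mul_of_nonneg_left (by linarith) (skewWeight_nonneg β)
      _ = _ := by ring
  refine (Finset.sum_le_sum fun β _ => hβ β).trans ?_
  rw [Finset.sum_add_distrib, ← Finset.mul_sum, ← Finset.sum_mul, sum_skewWeight,
    sum_skewWeight_mul_skewValue]
  simp

/-- The coefficient of the entry on the pair `e` in the quadratic form of a symmetric matrix. -/
def pairCoeff {V : Type*} [Fintype V] [DecidableEq V] (x : V → ℝ) (e : Sym2 V) : ℝ :=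
  ∑ p : V × V with s(p.1, p.2) = e, x p.1 * x p.2

theorem dotProduct_symMatrix_mulVec {V : Type*} [Fintype V] [DecidableEq V] (w : Sym2 V → ℝ)
    (x : V → ℝ) : x ⬝ᵥ (symMatrix w).mulVec x = ∑ e, w e * pairCoeff x e := by
  have h : x ⬝ᵥ (symMatrix w).mulVec x = ∑ p : V × V, w s(p.1, p.2) * (x p.1 * x p.2) := by
    rw [Fintype.sum_prod_type]
    simp only [dotProduct, Matrix.mulVec, symMatrix, Matrix.of_apply, Finset.mul_sum]
    exact Finset.sum_congr rfl fun i _ => Finset.sum_congr rfl fun j _ => by ring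
  rw [h, ← Finset.sum_fiberwise (s := Finset.univ) (g := fun p : V × V => s(p.1, p.2))]
  refine Finset.sum_congr rfl fun e _ => ?_
  rw [pairCoeff, Finset.mul_sum]
  exact Finset.sum_congr rfl fun p hp => by rw [(Finset.mem_filter.1 hp).2]

theorem sum_sq_pairCoeff_le {V : Type*} [Fintype V] [DecidableEq V] (x : V → ℝ) :
    ∑ e, pairCoeff x e ^ 2 ≤ 2 * (∑ i, x i ^ 2) ^ 2 := by
  have hcard : ∀ e : Sym2 V,
      (Finset.univ.filter fun p : V × V => s(p.1, p.2) = e).card ≤ 2 := by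
    intro e
    induction e using Sym2.ind with
    | _ a b =>
      refine (Finset.card_le_card (t := {(a, b), (b, a)}) fun p hp => ?_).trans
        Finset.card_le_two
      have := (Finset.mem_filter.1 hp).2
      rw [Sym2.eq_iff] at this
      rcases this with ⟨h1, h2⟩ | ⟨h1, h2⟩ <;> simp [Prod.ext_iff, h1, h2]
  calc ∑ e, pairCoeff x e ^ 2
      ≤ ∑ e : Sym2 V, 2 * ∑ p : V × V with s(p.1, p.2) = e, (x p.1 * x p.2) ^ 2 := by
        refine Finset.sum_le_sum fun e _ => sq_sum_le_card_mul_sum_sq.trans ?_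
        refine mul_le_mul_of_nonneg_right ?_ (Finset.sum_nonneg fun _ _ => sq_nonneg _)
        exact_mod_cast hcard e
    _ = 2 * ∑ p : V × V, (x p.1 * x p.2) ^ 2 := by
        rw [← Finset.mul_sum, Finset.sum_fiberwise]
    _ = 2 * (∑ i, x i ^ 2) ^ 2 := by
        rw [Fintype.sum_prod_type, sq (∑ i, x i ^ 2), Finset.sum_mul_sum]
        simp only [mul_pow]

/-- The expectation of a function of the signs of the comparison matrix. -/
noncomputable def skewMean {V : Type*} [Fintype V] [DecidableEq V] (F : (Sym2 V → Bool) → ℝ) : ℝ :=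
  ∑ b : Sym2 V → Bool, (∏ e, skewWeight (b e)) * F b

theorem skewMean_mono {V : Type*} [Fintype V] [DecidableEq V] {F G : (Sym2 V → Bool) → ℝ}
    (h : ∀ b, F b ≤ G b) : skewMean F ≤ skewMean G :=
  Finset.sum_le_sum fun b _ => mul_le_mul_of_nonneg_left (h b)
    (Finset.prod_nonneg fun _ _ => skewWeight_nonneg _)

theorem skewMean_exp_le {V : Type*} [Fintype V] [DecidableEq V] (x : V → ℝ) (t : ℝ) :
    skewMean (fun b => Real.exp (t * (x ⬝ᵥ (symMatrix fun e => skewValue (b e)).mulVec x))) ≤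
      Real.exp (8 * t ^ 2 * (∑ i, x i ^ 2) ^ 2) := by
  have h1 : skewMean (fun b : Sym2 V → Bool =>
      Real.exp (t * (x ⬝ᵥ (symMatrix fun e => skewValue (b e)).mulVec x))) =
      ∏ e, ∑ β, skewWeight β * Real.exp (t * pairCoeff x e * skewValue β) := by
    rw [Finset.prod_univ_sum, Fintype.piFinset_univ, skewMean]
    refine Finset.sum_congr rfl fun b _ => ?_
    rw [dotProduct_symMatrix_mulVec, Finset.prod_mul_distrib, Finset.mul_sum, Real.exp_sum]
    congr 1
    refine Finset.prod_congr rfl fun e _ => ?_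
    congr 1
    ring
  rw [h1]
  calc ∏ e, ∑ β, skewWeight β * Real.exp (t * pairCoeff x e * skewValue β)
      ≤ ∏ e, Real.exp (4 * (t * pairCoeff x e) ^ 2) := by
        refine Finset.prod_le_prod (fun e _ => Finset.sum_nonneg fun β _ =>
          mul_nonneg (skewWeight_nonneg β) (Real.exp_pos _).le) fun e _ =>
            sum_skewWeight_mul_exp_le _
    _ = Real.exp (4 * t ^ 2 * ∑ e, pairCoeff x e ^ 2) := by
        rw [← Real.exp_sum, Finset.mul_sum]
        congr 1
        exact Finset.sum_congr rfl fun e _ => by ring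
    _ ≤ _ := by
        refine Real.exp_le_exp.2 ?_
        have := mul_le_mul_of_nonneg_left (sum_sq_pairCoeff_le x)
          (by positivity : 0 ≤ 4 * t ^ 2)
        linarith

theorem pow_two_mul_le_factorial_mul (x : ℝ) (k : ℕ) :
    x ^ (2 * k) ≤ (2 * k).factorial * (Real.exp x + Real.exp (-x)) := by
  have h := Real.pow_div_factorial_le_exp |x| (abs_nonneg x) (2 * k)
  rw [(even_two_mul k).pow_abs, div_le_iff₀ (by positivity), mul_comm (Real.exp _)] at h
  refine h.trans (mul_le_mul_of_nonneg_left ?_ (by positivity))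
  rcases abs_choice x with h | h <;> rw [h] <;> linarith [Real.exp_pos x, Real.exp_pos (-x)]

theorem skewMean_pow_le {V : Type*} [Fintype V] [DecidableEq V] (x : V → ℝ) (t : ℝ) (k : ℕ) :
    skewMean (fun b => (t * (x ⬝ᵥ (symMatrix fun e => skewValue (b e)).mulVec x)) ^ (2 * k)) ≤
      (2 * k).factorial * (2 * Real.exp (8 * t ^ 2 * (∑ i, x i ^ 2) ^ 2)) := by
  refine (skewMean_mono fun b => pow_two_mul_le_factorial_mul _ k).trans ?_
  have h1 := skewMean_exp_le x t
  have h2 := skewMean_exp_le x (-t)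
  simp only [neg_mul, neg_sq] at h2
  have : ∀ F G : (Sym2 V → Bool) → ℝ, ∀ C : ℝ,
      skewMean (fun b => C * (F b + G b)) = C * (skewMean F + skewMean G) := by
    intro F G C
    simp only [skewMean, ← Finset.sum_add_distrib, Finset.mul_sum]
    exact Finset.sum_congr rfl fun b _ => by ring
  rw [this]
  refine mul_le_mul_of_nonneg_left ?_ (by positivity)
  linarith

/-- There are at most `(C k) ^ k` closed walks of length `2 k` on `2 k` vertices that use no edge
exactly once. -/
theorem exists_card_goodWalks_le : ∃ C : ℝ, 0 < C ∧ ∀ k : ℕ, 0 < k →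
    ((goodWalks (Fin (2 * k)) (2 * k)).card : ℝ) ≤ (C * k) ^ k := by
  refine ⟨(2 ^ 32 * 3) ^ 2 * Real.exp 8192, by positivity, fun k hk => ?_⟩
  have hk' : (0 : ℝ) < k := by exact_mod_cast hk
  set Y : (Sym2 (Fin (2 * k)) → Bool) → Matrix (Fin (2 * k)) (Fin (2 * k)) ℝ :=
    fun b => symMatrix fun e => skewValue (b e) with hY
  set Q : (Fin (2 * k) → ℤ) → (Sym2 (Fin (2 * k)) → Bool) → ℝ :=
    fun z b => (fun j => (z j : ℝ)) ⬝ᵥ (Y b).mulVec fun j => (z j : ℝ) with hQ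
  -- the parameter of the exponential moment that balances the factorial and the exponential
  set t : ℝ := (2 * Real.sqrt k)⁻¹ with ht
  have ht2 : t ^ 2 = (4 * (k : ℝ))⁻¹ := by
    rw [ht, inv_pow, mul_pow, Real.sq_sqrt hk'.le]
    ring_nf
  have ht0 : 0 < t := by positivity
  have h1 : ((goodWalks (Fin (2 * k)) (2 * k)).card : ℝ) ≤
      skewMean fun b => (Y b ^ (2 * k)).trace :=
    card_goodWalks_le (fun _ => skewWeight) (fun _ => skewValue) (2 * k)
      (fun _ => sum_skewWeight) (fun _ => sum_skewWeight_mul_skewValue)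
      fun _ _ hm => one_le_sum_skewWeight_mul_pow hm
  have h2 : (skewMean fun b => (Y b ^ (2 * k)).trace) ≤
      (2 * k : ℝ) * ∑ z ∈ integerNet (2 * k), ((64 * k : ℝ) ^ k)⁻¹ *
        skewMean fun b => (t * Q z b) ^ (2 * k) := by
    have h3 : (skewMean fun b => (Y b ^ (2 * k)).trace) ≤
        skewMean fun b => (2 * k : ℝ) * ∑ z ∈ integerNet (2 * k),
          ((64 * k : ℝ) ^ k)⁻¹ * (t * Q z b) ^ (2 * k) := by
      refine skewMean_mono fun b => ?_
      refine (trace_pow_le_sum_integerNet (by omega) (symMatrix_isHermitian _) k).trans_eq ?_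
      rw [Nat.cast_mul, Nat.cast_ofNat]
      congr 1
      refine Finset.sum_congr rfl fun z _ => ?_
      change (Q z b / _) ^ (2 * k) = _
      rw [pow_mul, pow_mul, div_pow, mul_pow t, ht2, ← inv_pow, ← mul_pow]
      congr 1
      field_simp
      norm_num
    refine h3.trans_eq ?_
    simp only [skewMean, Finset.mul_sum]
    rw [Finset.sum_comm]
    exact Finset.sum_congr rfl fun z _ => Finset.sum_congr rfl fun b _ => by ring
  have h4 : ∀ z ∈ integerNet (2 * k), (skewMean fun b => (t * Q z b) ^ (2 * k)) ≤
      (4 * k ^ 2 : ℝ) ^ k * (2 * Real.exp 8192 ^ k) := by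
    intro z hz
    refine (skewMean_pow_le _ t k).trans ?_
    have hz2 : ∑ j, (z j : ℝ) ^ 2 ≤ 64 * k := by
      have := (Finset.mem_filter.1 hz).2
      have h : ∑ j, (z j : ℝ) ^ 2 ≤ 32 * ((2 * k : ℕ) : ℝ) := by exact_mod_cast this
      push_cast at h
      linarith
    have hfac : ((2 * k).factorial : ℝ) ≤ (4 * k ^ 2 : ℝ) ^ k := by
      have h : ((2 * k).factorial : ℝ) ≤ ((2 * k : ℕ) : ℝ) ^ (2 * k) := by
        exact_mod_cast Nat.factorial_le_pow (2 * k)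
      refine h.trans_eq ?_
      rw [pow_mul]
      push_cast
      congr 1
      ring
    have hexp : Real.exp (8 * t ^ 2 * (∑ j, (z j : ℝ) ^ 2) ^ 2) ≤ Real.exp 8192 ^ k := by
      rw [← Real.exp_nat_mul]
      refine Real.exp_le_exp.2 ?_
      have h0 : (0 : ℝ) ≤ ∑ j, (z j : ℝ) ^ 2 := Finset.sum_nonneg fun _ _ => sq_nonneg _
      calc 8 * t ^ 2 * (∑ j, (z j : ℝ) ^ 2) ^ 2 ≤ 8 * t ^ 2 * (64 * k) ^ 2 := by gcongr
        _ = (k : ℝ) * 8192 := by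
          rw [ht2]
          field_simp
          norm_num
    gcongr
  have h5 : ((integerNet (2 * k)).card : ℝ) ≤ ((2 ^ 32 * 3) ^ 2) ^ k := by
    rw [← pow_mul]
    exact card_integerNet_le (2 * k)
  have h6 : (4 * k : ℝ) ≤ 4 ^ k := by
    have h : 4 * k ≤ 4 ^ k := by
      clear * - hk
      induction k with
      | zero => omega
      | succ k ih =>
        rcases Nat.eq_zero_or_pos k with rfl | h
        · norm_num
        · have := ih h
          rw [pow_succ]
          omega
    exact_mod_cast h
  calc ((goodWalks (Fin (2 * k)) (2 * k)).card : ℝ)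
      ≤ (2 * k : ℝ) * ∑ z ∈ integerNet (2 * k), ((64 * k : ℝ) ^ k)⁻¹ *
          skewMean fun b => (t * Q z b) ^ (2 * k) := h1.trans h2
    _ ≤ (2 * k : ℝ) * ∑ _z ∈ integerNet (2 * k), ((64 * k : ℝ) ^ k)⁻¹ *
          ((4 * k ^ 2 : ℝ) ^ k * (2 * Real.exp 8192 ^ k)) := by
        gcongr with z hz
        exact h4 z hz
    _ = (4 * k) * (integerNet (2 * k)).card *
          (((64 * k : ℝ) ^ k)⁻¹ * (4 * k ^ 2 : ℝ) ^ k * Real.exp 8192 ^ k) := by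
        rw [Finset.sum_const, nsmul_eq_mul]
        ring
    _ ≤ 4 ^ k * ((2 ^ 32 * 3) ^ 2) ^ k *
          (((64 * k : ℝ) ^ k)⁻¹ * (4 * k ^ 2 : ℝ) ^ k * Real.exp 8192 ^ k) := by gcongr
    _ = ((2 ^ 32 * 3) ^ 2 * Real.exp 8192 * k / 4) ^ k := by
        rw [← inv_pow, ← mul_pow, ← mul_pow, ← mul_pow, ← mul_pow]
        congr 1
        field_simp
        ring
    _ ≤ ((2 ^ 32 * 3) ^ 2 * Real.exp 8192 * k) ^ k := by
        refine pow_le_pow_left₀ (by positivity) (div_le_self (by positivity) (by norm_num)) k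

/-! ### Concentration of the adjacency matrix in spectral norm -/

/-- The Bernoulli weights. -/
def bernoulliWeight (p : ℝ) (β : Bool) : ℝ := if β then p else 1 - p

/-- The centred Bernoulli values. -/
def bernoulliValue (p : ℝ) (β : Bool) : ℝ := (if β then 1 else 0) - p

theorem bernoulliWeight_nonneg {p : ℝ} (h0 : 0 ≤ p) (h1 : p ≤ 1) (β : Bool) :
    0 ≤ bernoulliWeight p β := by
  cases β <;> simp [bernoulliWeight, h0, h1]

theorem sum_bernoulliWeight (p : ℝ) : ∑ β, bernoulliWeight p β = 1 := by
  simp [bernoulliWeight]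

theorem sum_bernoulliWeight_mul_bernoulliValue (p : ℝ) :
    ∑ β, bernoulliWeight p β * bernoulliValue p β = 0 := by
  simp [bernoulliWeight, bernoulliValue]
  ring

theorem abs_sum_bernoulliWeight_mul_pow_le {p : ℝ} (h0 : 0 ≤ p) (h1 : p ≤ 1) {m : ℕ}
    (hm : 2 ≤ m) : |∑ β, bernoulliWeight p β * bernoulliValue p β ^ m| ≤ p := by
  have h : ∑ β, bernoulliWeight p β * bernoulliValue p β ^ m =
      p * (1 - p) ^ m + (1 - p) * (-p) ^ m := by
    simp [bernoulliWeight, bernoulliValue]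
  rw [h]
  have h2 : 0 ≤ 1 - p := by linarith
  have e1 : (1 - p) ^ m ≤ (1 - p) ^ 2 := pow_le_pow_of_le_one h2 (by linarith) hm
  have e2 : |(-p) ^ m| ≤ p ^ 2 := by
    rw [abs_pow, abs_neg, abs_of_nonneg h0]
    exact pow_le_pow_of_le_one h0 h1 hm
  have e3 : 0 ≤ (1 - p) ^ m := pow_nonneg h2 m
  calc |p * (1 - p) ^ m + (1 - p) * (-p) ^ m|
      ≤ |p * (1 - p) ^ m| + |(1 - p) * (-p) ^ m| := abs_add_le _ _
    _ = p * (1 - p) ^ m + (1 - p) * |(-p) ^ m| := by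
        rw [abs_mul, abs_mul, abs_of_nonneg h0, abs_of_nonneg h2, abs_of_nonneg e3]
    _ ≤ p * (1 - p) ^ 2 + (1 - p) * p ^ 2 :=
        add_le_add (mul_le_mul_of_nonneg_left e1 h0) (mul_le_mul_of_nonneg_left e2 h2)
    _ ≤ p := by nlinarith

/-- The trace moment of order `2 k` of a centred symmetric Bernoulli matrix with parameters at most
`α`, for `k` at least `α n`. The constant `C` bounds the number of walks on `2 k` vertices. -/
theorem sum_bernoulliWeight_mul_trace_le {C : ℝ} {n k : ℕ} (hk : 0 < k)
    (hC : ((goodWalks (Fin (2 * k)) (2 * k)).card : ℝ) ≤ (C * k) ^ k) {α : ℝ} (hα0 : 0 ≤ α)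
    (hα1 : α ≤ 1) (hαn : α * n ≤ k) {p : Sym2 (Fin n) → ℝ} (hp0 : ∀ e, 0 ≤ p e)
    (hpα : ∀ e, p e ≤ α) :
    ∑ b : Sym2 (Fin n) → Bool, (∏ e, bernoulliWeight (p e) (b e)) *
      (symMatrix (fun e => bernoulliValue (p e) (b e)) ^ (2 * k)).trace ≤ n * (C * k) ^ k := by
  refine (sum_prod_mul_trace_le (fun e => bernoulliWeight (p e)) (fun e => bernoulliValue (p e))
    (2 * k) hα0 hα1 (fun e => sum_bernoulliWeight _)
    (fun e => sum_bernoulliWeight_mul_bernoulliValue _) fun e m hm =>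
      (abs_sum_bernoulliWeight_mul_pow_le (hp0 e) ((hpα e).trans hα1) hm).trans (hpα e)).trans ?_
  exact (sum_goodWalks_le hk hα0 hαn).trans (mul_le_mul_of_nonneg_left hC (Nat.cast_nonneg n))

theorem prod_Ici_eq_prod_sym2 {n : ℕ} {R : Type*} [CommMonoid R] (f : Sym2 (Fin n) → R) :
    ∏ i : Fin n, ∏ j ∈ Finset.Ici i, f s(i, j) = ∏ e, f e := by
  rw [← Sym2.sortEquiv.symm.prod_comp]
  have h : ∀ p : {p : Fin n × Fin n // p.1 ≤ p.2},
      f (Sym2.sortEquiv.symm p) = f s(p.1.1, p.1.2) := fun p => rfl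
  simp only [h]
  rw [← Finset.prod_subtype (Finset.univ.filter fun p : Fin n × Fin n => p.1 ≤ p.2)
    (p := fun p => p.1 ≤ p.2) (f := fun p => f s(p.1, p.2)) (by simp), Finset.prod_filter,
    Fintype.prod_prod_type]
  refine Finset.prod_congr rfl fun i _ => ?_
  rw [← Finset.prod_filter]
  exact Finset.prod_congr (by ext j; simp) fun _ _ => rfl

/-- The connection probabilities of the positions `x`, as a function on unordered pairs. -/
def edgeProb {S : Type*} {n : ℕ} (W : S → S → ℝ) (hW : ∀ x y, W x y = W y x) (α : ℝ)
    (x : Fin n → S) : Sym2 (Fin n) → ℝ :=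
  Sym2.lift ⟨fun i j => α * W (x i) (x j), fun _ _ => congrArg (α * ·) (hW _ _)⟩

/-- The adjacency matrix with edges `b`. -/
def boolMatrix {n : ℕ} (b : Sym2 (Fin n) → Bool) : Matrix (Fin n) (Fin n) ℝ :=
  symMatrix fun e => if b e then 1 else 0

theorem boolMatrix_sub_eq {S : Type*} {n : ℕ} (W : S → S → ℝ) (hW : ∀ x y, W x y = W y x) (α : ℝ)
    (x : Fin n → S) (b : Sym2 (Fin n) → Bool) :
    boolMatrix b - α • gramMatrix W x =
      symMatrix fun e => bernoulliValue (edgeProb W hW α x e) (b e) := by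
  ext i j
  simp [boolMatrix, symMatrix, gramMatrix, bernoulliValue, edgeProb]

theorem exists_eq_boolMatrix {n : ℕ} {A : Matrix (Fin n) (Fin n) ℝ} (hA : A.IsHermitian)
    (h01 : ∀ i j, A i j = 0 ∨ A i j = 1) : ∃ b, A = boolMatrix b := by
  classical
  have hs : ∀ i j, A i j = A j i := fun i j => by simpa using hA.apply j i
  refine ⟨Sym2.lift ⟨fun i j => decide (A i j = 1), fun i j => by simp only [hs i j]⟩, ?_⟩
  ext i j
  rcases h01 i j with h | h <;> simp [boolMatrix, symMatrix, h]

theorem continuous_gramMatrix {S : Type*} [TopologicalSpace S] {n : ℕ} {W : S → S → ℝ}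
    (hW : Continuous fun p : S × S => W p.1 p.2) :
    Continuous fun x : Fin n → S => gramMatrix W x := by
  refine continuous_matrix fun i j => ?_
  exact hW.comp (f := fun x : Fin n → S => (x i, x j))
    ((continuous_apply i).prodMk (continuous_apply j))

section Graph

variable {S : Type*} [TopologicalSpace S] [MeasurableSpace S]
  [SecondCountableTopology S] [OpensMeasurableSpace S] {μ : Measure S} {W : S → S → ℝ}
  {Ω : Type*} [MeasurableSpace Ω] {P : Measure Ω} {α : ℝ} {n : ℕ} {X : Fin n → Ω → S}
  {A : Ω → Matrix (Fin n) (Fin n) ℝ}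

/-- Markov's inequality for the trace moment of the centred adjacency matrix. The event is split
according to the finitely many values of the adjacency matrix, and the law of the edges given the
positions is used on each part. -/
theorem measure_le_trace_pow_le [IsProbabilityMeasure P] (hW : IsConnectivityKernel μ W)
    (hG : IsLatentPositionGraph P μ W α X A) (hα0 : 0 ≤ α) (hα1 : α ≤ 1) {C : ℝ} {k : ℕ}
    (hk : 0 < k) (hC : ((goodWalks (Fin (2 * k)) (2 * k)).card : ℝ) ≤ (C * k) ^ k)
    (hαn : α * n ≤ k) {T : ℝ} (hT : 0 < T) :
    P {ω | T ≤ ((A ω - α • gramMatrix W fun i => X i ω) ^ (2 * k)).trace} ≤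
      ENNReal.ofReal (n * (C * k) ^ k / T) := by
  classical
  set p : Ω → Sym2 (Fin n) → ℝ := fun ω => edgeProb W hW.symm α fun i => X i ω with hp
  have hp0 : ∀ ω e, 0 ≤ p ω e := by
    intro ω e
    induction e using Sym2.ind with
    | _ i j => exact mul_nonneg hα0 (hW.mem_Icc _ _).1
  have hpα : ∀ ω e, p ω e ≤ α := by
    intro ω e
    induction e using Sym2.ind with
    | _ i j => exact mul_le_of_le_one_right hα0 (hW.mem_Icc _ _).2
  let tr : (Sym2 (Fin n) → Bool) → (Fin n → S) → ℝ := fun b x =>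
    ((boolMatrix b - α • gramMatrix W x) ^ (2 * k)).trace
  have htr_cont : ∀ b, Continuous (tr b) := fun b =>
    ((continuous_const.sub ((continuous_gramMatrix hW.continuous).const_smul α)).pow _).matrix_trace
  have hX : Measurable fun ω => fun i => X i ω :=
    measurable_pi_lambda _ hG.measurable_position
  have htr_meas : ∀ b, Measurable fun ω => tr b fun i => X i ω := fun b =>
    (htr_cont b).measurable.comp hX
  have htr0 : ∀ b x, 0 ≤ tr b x := by
    intro b x
    have hH : (boolMatrix b - α • gramMatrix W x).IsHermitian := by
      rw [boolMatrix_sub_eq W hW.symm]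
      exact symMatrix_isHermitian _
    simp only [tr]
    rw [trace_pow_eq_sum_eigenvalues_pow hH]
    exact Finset.sum_nonneg fun i _ => (even_two_mul k).pow_nonneg _
  let wt : (Sym2 (Fin n) → Bool) → Ω → ℝ := fun b ω => ∏ e, bernoulliWeight (p ω e) (b e)
  have hwt0 : ∀ b ω, 0 ≤ wt b ω := fun b ω =>
    Finset.prod_nonneg fun e _ => bernoulliWeight_nonneg (hp0 ω e) ((hpα ω e).trans hα1) _
  have hpart : ∀ b, P ({ω | T ≤ tr b fun i => X i ω} ∩ {ω | A ω = boolMatrix b}) ≤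
      ∫⁻ ω, ENNReal.ofReal (wt b ω * (tr b fun i => X i ω) / T) ∂P := by
    intro b
    have hC : MeasurableSet {x : Fin n → S | T ≤ tr b x} :=
      measurableSet_le measurable_const (htr_cont b).measurable
    have h := hG.cond_law _ hC fun i j => b s(i, j)
    have hset : {ω | A ω = boolMatrix b} =
        {ω | ∀ i j, i ≤ j → A ω i j = if b s(i, j) then 1 else 0} := by
      ext ω
      refine ⟨fun h i j _ => by rw [show A ω = boolMatrix b from h]; rfl, fun h => ?_⟩
      have hs : ∀ i j, A ω i j = A ω j i := fun i j => by
        simpa using (hG.isHermitian ω).apply j i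
      change A ω = boolMatrix b
      ext i j
      rcases le_total i j with hij | hij
      · rw [h i j hij]; rfl
      · rw [hs, h j i hij, Sym2.eq_swap]; rfl
    have hw : ∀ ω, ∏ i : Fin n, ∏ j ∈ Finset.Ici i, ENNReal.ofReal
        (if b s(i, j) then α * W (X i ω) (X j ω) else 1 - α * W (X i ω) (X j ω)) =
        ENNReal.ofReal (wt b ω) := by
      intro ω
      rw [ENNReal.ofReal_prod_of_nonneg fun e _ =>
        bernoulliWeight_nonneg (hp0 ω e) ((hpα ω e).trans hα1) _, ← prod_Ici_eq_prod_sym2]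
      rfl
    simp only [hw] at h
    rw [hset]
    refine h.le.trans ?_
    have hmeas : MeasurableSet {ω | (fun i => X i ω) ∈ {x : Fin n → S | T ≤ tr b x}} := hX hC
    rw [← lintegral_indicator hmeas]
    refine lintegral_mono fun ω => ?_
    by_cases hω : ω ∈ {ω | (fun i => X i ω) ∈ {x : Fin n → S | T ≤ tr b x}}
    · rw [Set.indicator_of_mem hω]
      refine ENNReal.ofReal_le_ofReal ?_
      rw [le_div_iff₀ hT]
      exact mul_le_mul_of_nonneg_left hω (hwt0 b ω)
    · rw [Set.indicator_of_notMem hω]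
      exact zero_le
  have hwt_meas : ∀ b, Measurable (wt b) := by
    intro b
    refine Finset.measurable_prod _ fun e _ => ?_
    have hpe : Measurable fun ω => p ω e := by
      induction e using Sym2.ind with
      | _ i j =>
        have hc : Continuous fun x : Fin n → S => α * W (x i) (x j) :=
          continuous_const.mul
            (hW.continuous.comp (f := fun x : Fin n → S => (x i, x j))
              ((continuous_apply i).prodMk (continuous_apply j)))
        exact hc.measurable.comp hX
    cases hb : b e
    · simpa [bernoulliWeight] using hpe.const_sub 1
    · simpa [bernoulliWeight] using hpe
  calc P {ω | T ≤ ((A ω - α • gramMatrix W fun i => X i ω) ^ (2 * k)).trace}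
      ≤ P (⋃ b, ({ω | T ≤ tr b fun i => X i ω} ∩ {ω | A ω = boolMatrix b})) := by
        refine measure_mono fun ω hω => ?_
        obtain ⟨b, hb⟩ := exists_eq_boolMatrix (hG.isHermitian ω) (hG.entry_eq ω)
        refine Set.mem_iUnion.2 ⟨b, ?_, hb⟩
        change T ≤ tr b _
        simp only [tr]
        rw [← hb]
        exact hω
    _ ≤ ∑ b, P ({ω | T ≤ tr b fun i => X i ω} ∩ {ω | A ω = boolMatrix b}) :=
        measure_iUnion_fintype_le _ _
    _ ≤ ∑ b, ∫⁻ ω, ENNReal.ofReal (wt b ω * (tr b fun i => X i ω) / T) ∂P :=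
        Finset.sum_le_sum fun b _ => hpart b
    _ = ∫⁻ ω, ∑ b, ENNReal.ofReal (wt b ω * (tr b fun i => X i ω) / T) ∂P := by
        rw [lintegral_finsetSum]
        exact fun b _ => (((hwt_meas b).mul (htr_meas b)).div_const T).ennreal_ofReal
    _ ≤ ∫⁻ _ω, ENNReal.ofReal (n * (C * k) ^ k / T) ∂P := by
        refine lintegral_mono fun ω => ?_
        rw [← ENNReal.ofReal_sum_of_nonneg fun b _ =>
          div_nonneg (mul_nonneg (hwt0 b ω) (htr0 b _)) hT.le, ← Finset.sum_div]
        refine ENNReal.ofReal_le_ofReal (div_le_div_of_nonneg_right ?_ hT.le)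
        have h := sum_bernoulliWeight_mul_trace_le hk hC hα0 hα1 hαn (hp0 ω) (hpα ω)
        simpa only [tr, boolMatrix_sub_eq W hW.symm] using h
    _ = ENNReal.ofReal (n * (C * k) ^ k / T) := by simp

end Graph

/-- A bound on the trace of an even power bounds the spectral norm. -/
theorem posSemidef_sq_sub_of_trace_pow_le {V : Type*} [Fintype V] [DecidableEq V]
    {H : Matrix V V ℝ} (hH : H.IsHermitian) {E2 : ℝ} (hE : 0 ≤ E2) {k : ℕ} (hk : 0 < k)
    (h : (H ^ (2 * k)).trace ≤ E2 ^ k) :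
    (E2 • (1 : Matrix V V ℝ) - H * H).PosSemidef := by
  have hl : ∀ i, hH.eigenvalues i ^ 2 ≤ E2 := by
    intro i
    rw [trace_pow_eq_sum_eigenvalues_pow hH] at h
    have h1 : hH.eigenvalues i ^ (2 * k) ≤ E2 ^ k :=
      (Finset.single_le_sum (f := fun i => hH.eigenvalues i ^ (2 * k))
        (fun i _ => (even_two_mul k).pow_nonneg _) (Finset.mem_univ i)).trans h
    rw [pow_mul] at h1
    exact le_of_pow_le_pow_left₀ hk.ne' hE h1
  have h2 : E2 • (1 : Matrix V V ℝ) - H * H = eigenMatrix hH *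
      Matrix.diagonal (fun i => E2 - hH.eigenvalues i ^ 2) * (eigenMatrix hH).transpose := by
    have h3 : Matrix.diagonal (fun i => E2 - hH.eigenvalues i ^ 2) =
        E2 • (1 : Matrix V V ℝ) - Matrix.diagonal fun i => hH.eigenvalues i ^ 2 := by
      rw [← Matrix.diagonal_one, ← Matrix.diagonal_smul, Matrix.diagonal_sub]
      congr 1
      ext i
      simp
    rw [h3, Matrix.mul_sub, Matrix.sub_mul, ← pow_eq_eigenMatrix_mul, Matrix.mul_smul,
      Matrix.mul_one, Matrix.smul_mul, eigenMatrix_mul_transpose_self, sq]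
  rw [h2, ← Matrix.conjTranspose_eq_transpose_of_trivial]
  exact (Matrix.PosSemidef.diagonal fun i => sub_nonneg.2 (hl i)).mul_mul_conjTranspose_same _

/-- The adjacency matrix of a latent position graph with `α ≥ κ log n / n` is within `C √(α n)`, in
spectral norm, of the matrix of its connection probabilities, up to a probability that decays as any
prescribed power of `n`. The trace moment of order a large multiple of `α n` gives this without a
logarithmic loss. -/
theorem exists_spectral_concentration {κ q : ℝ} (hκ : 0 < κ) (hq : 0 < q) :
    ∃ C : ℝ, 0 < C ∧ ∀ {S : Type*} [TopologicalSpace S] [MeasurableSpace S]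
      [SecondCountableTopology S] [OpensMeasurableSpace S] {μ : Measure S} {W : S → S → ℝ}
      {Ω : Type*} [MeasurableSpace Ω] {P : Measure Ω} [IsProbabilityMeasure P] {α : ℝ} {n : ℕ}
      {X : Fin n → Ω → S} {A : Ω → Matrix (Fin n) (Fin n) ℝ}, IsConnectivityKernel μ W →
      IsLatentPositionGraph P μ W α X A → 2 ≤ n → 0 < α → α ≤ 1 → κ * (Real.log n / n) ≤ α →
      P {ω | ¬ ((C * (α * n)) • (1 : Matrix (Fin n) (Fin n) ℝ) -
          (A ω - α • gramMatrix W fun i => X i ω) *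
          (A ω - α • gramMatrix W fun i => X i ω)).PosSemidef} ≤
        ENNReal.ofReal ((n : ℝ) ^ (-(1 / q))) := by
  obtain ⟨C₀, hC₀, hcount⟩ := exists_card_goodWalks_le
  set c₁ : ℝ := 1 + (1 + 1 / q) / κ with hc₁
  have hlog2 : 0 < Real.log 2 := Real.log_pos (by norm_num)
  set c₂ : ℝ := c₁ + 1 / (κ * Real.log 2) with hc₂
  have hc₁0 : 0 < c₁ := by positivity
  refine ⟨Real.exp 1 * C₀ * c₂, by positivity, ?_⟩
  intro S _ _ _ _ μ W Ω _ P _ α n X A hW hG hn hα0 hα1 hκα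
  have hn0 : (0 : ℝ) < n := by positivity
  set D : ℝ := α * n with hD
  have hD0 : 0 < D := by positivity
  have hDlog : κ * Real.log n ≤ D := by
    have := mul_le_mul_of_nonneg_right hκα hn0.le
    rwa [mul_assoc, div_mul_cancel₀ _ hn0.ne'] at this
  have hlogn : Real.log 2 ≤ Real.log n :=
    Real.log_le_log (by norm_num) (by exact_mod_cast hn)
  have hD2 : κ * Real.log 2 ≤ D := (mul_le_mul_of_nonneg_left hlogn hκ.le).trans hDlog
  set k : ℕ := ⌈c₁ * D⌉₊ with hk
  have hk0 : 0 < k := Nat.ceil_pos.2 (by positivity)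
  have hk0' : (0 : ℝ) < k := by exact_mod_cast hk0
  have hk1 : c₁ * D ≤ k := Nat.le_ceil _
  have hk2 : (k : ℝ) ≤ c₂ * D := by
    have h1 : (k : ℝ) < c₁ * D + 1 := Nat.ceil_lt_add_one (by positivity)
    have h2 : 1 ≤ 1 / (κ * Real.log 2) * D := by
      rw [one_div, inv_mul_eq_div, one_le_div (by positivity)]
      exact hD2
    rw [hc₂, add_mul]
    linarith
  have hDk : D ≤ k := by
    refine le_trans ?_ hk1
    rw [hc₁, add_mul, one_mul]
    have : 0 ≤ (1 + 1 / q) / κ * D := by positivity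
    linarith
  have hlogk : (1 + 1 / q) * Real.log n ≤ k := by
    refine le_trans ?_ hk1
    have h1 : (1 + 1 / q) * Real.log n ≤ (1 + 1 / q) / κ * D := by
      rw [div_mul_eq_mul_div, le_div_iff₀ hκ]
      have := mul_le_mul_of_nonneg_left hDlog (by positivity : 0 ≤ 1 + 1 / q)
      linarith
    rw [hc₁, add_mul, one_mul]
    linarith
  have hT : 0 < (Real.exp 1 * C₀ * k) ^ k := by positivity
  have hmarkov := measure_le_trace_pow_le hW hG hα0.le hα1 hk0 (hcount k hk0) hDk hT
  refine (measure_mono fun ω hω => ?_).trans (hmarkov.trans (ENNReal.ofReal_le_ofReal ?_))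
  · by_contra hlt
    refine hω (posSemidef_sq_sub_of_trace_pow_le ?_ (by positivity) hk0
      ((not_le.1 hlt).le.trans ?_))
    · obtain ⟨b, hb⟩ := exists_eq_boolMatrix (hG.isHermitian ω) (hG.entry_eq ω)
      rw [hb, boolMatrix_sub_eq W hW.symm]
      exact symMatrix_isHermitian _
    · refine pow_le_pow_left₀ (by positivity) ?_ k
      rw [mul_assoc (Real.exp 1 * C₀)]
      exact mul_le_mul_of_nonneg_left hk2 (by positivity)
  · have h1 : n * (C₀ * k) ^ k / (Real.exp 1 * C₀ * k) ^ k = n * Real.exp (-(k : ℝ)) := by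
      rw [mul_assoc (Real.exp 1), mul_pow (Real.exp 1), Real.exp_neg, ← Real.exp_one_pow]
      have : (C₀ * (k : ℝ)) ^ k ≠ 0 := by positivity
      field_simp
    have h2 : (n : ℝ) ^ (-(1 / q)) = n * Real.exp (-((1 + 1 / q) * Real.log n)) := by
      conv_rhs => rw [← Real.exp_log hn0]
      rw [← Real.exp_add, Real.rpow_def_of_pos hn0, Real.exp_log hn0]
      congr 1
      ring
    rw [h1, h2]
    gcongr

/-! ### Positivity of the Gram matrix on the support of the position distribution -/

/-- A compact self-adjoint operator without negative eigenvalue is positive: the spectral radius of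
`‖T‖ - T` is then at most `‖T‖`, and it is the norm of that operator. -/
theorem inner_nonneg_of_isCompactOperator {E : Type*} [NormedAddCommGroup E]
    [InnerProductSpace ℝ E] [CompleteSpace E] {T : E →L[ℝ] E} (hT : IsCompactOperator T)
    (hsymm : (T : E →ₗ[ℝ] E).IsSymmetric)
    (hpos : ∀ l : ℝ, Module.End.HasEigenvalue (T : Module.End ℝ E) l → 0 ≤ l) (f : E) :
    0 ≤ inner ℝ (T f) f := by
  rcases subsingleton_or_nontrivial E with hE | hE
  · rw [Subsingleton.elim f 0]
    simp
  set R : E →L[ℝ] E := algebraMap ℝ (E →L[ℝ] E) ‖T‖ - T with hR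
  have hspec : ∀ m ∈ spectrum ℝ R, ‖m‖ ≤ ‖T‖ := by
    intro m hm
    rw [hR, ← spectrum.singleton_sub_eq] at hm
    obtain ⟨a, ha, l, hl, rfl⟩ := Set.mem_sub.1 hm
    rw [Set.mem_singleton_iff] at ha
    subst ha
    have h1 : ‖l‖ ≤ ‖T‖ := by simpa using spectrum.norm_le_norm_mul_of_mem hl
    have h2 : 0 ≤ l := by
      by_cases h0 : l = 0
      · exact h0.ge
      · exact hpos l ((hT.hasEigenvalue_iff_mem_spectrum h0).2 hl)
    rw [Real.norm_of_nonneg h2] at h1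
    rw [Real.norm_of_nonneg (by linarith)]
    linarith
  have hRsa : IsSelfAdjoint R := by
    have h1 : IsSelfAdjoint T := (ContinuousLinearMap.isSelfAdjoint_iff_isSymmetric).2 hsymm
    refine IsSelfAdjoint.sub ?_ h1
    rw [Algebra.algebraMap_eq_smul_one]
    exact (IsSelfAdjoint.all ‖T‖).smul (IsSelfAdjoint.one _)
  have hnorm : ‖R‖ ≤ ‖T‖ := by
    have h1 := R.spectralRadius_eq_nnnorm hRsa
    have h2 : spectralRadius ℝ R ≤ ‖T‖₊ := by
      refine iSup₂_le fun m hm => ?_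
      exact_mod_cast hspec m hm
    rw [h1] at h2
    exact_mod_cast h2
  have h1 : inner ℝ (R f) f ≤ ‖T‖ * ‖f‖ ^ 2 := by
    refine (real_inner_le_norm _ _).trans ?_
    calc ‖R f‖ * ‖f‖ ≤ (‖R‖ * ‖f‖) * ‖f‖ :=
          mul_le_mul_of_nonneg_right (R.le_opNorm f) (norm_nonneg f)
      _ ≤ (‖T‖ * ‖f‖) * ‖f‖ := by gcongr
      _ = _ := by ring
  have h2 : inner ℝ (R f) f = ‖T‖ * ‖f‖ ^ 2 - inner ℝ (T f) f := by
    rw [hR, sub_apply, inner_sub_left, Algebra.algebraMap_eq_smul_one,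
      smul_apply, one_apply_eq_self, real_inner_smul_left,
      real_inner_self_eq_norm_sq]
  linarith

section FeatureMap

variable {E : Type*} [NormedAddCommGroup E] [InnerProductSpace ℝ E]
  {S : Type*} [TopologicalSpace S] [CompactSpace S]

/-- The operator `f ↦ (x ↦ ⟪φ x, f⟫)` associated with a continuous map `φ` from a compact space to
a Hilbert space. -/
noncomputable def evalFeature (φ : C(S, E)) : E →L[ℝ] BoundedContinuousFunction S ℝ :=
  LinearMap.mkContinuous
    { toFun := fun f => BoundedContinuousFunction.mkOfCompact
        ⟨fun x => inner ℝ (φ x) f, φ.continuous.inner continuous_const⟩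
      map_add' := fun f g => by ext x; simp [inner_add_right]
      map_smul' := fun c f => by ext x; simp [real_inner_smul_right] } ‖φ‖ fun f => by
    refine (BoundedContinuousFunction.norm_le (by positivity)).2 fun x => ?_
    exact (norm_inner_le_norm _ _).trans
      (mul_le_mul_of_nonneg_right (φ.norm_coe_le_norm x) (norm_nonneg f))

theorem evalFeature_apply (φ : C(S, E)) (f : E) (x : S) :
    evalFeature φ f x = inner ℝ (φ x) f := rfl

theorem isCompactOperator_evalFeature (φ : C(S, E)) : IsCompactOperator (evalFeature φ) := by
  rw [show (evalFeature φ : E → _) = ((evalFeature φ : E →ₗ[ℝ] _) : E → _) from rfl,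
    isCompactOperator_iff_isCompact_closure_image_closedBall (𝕜₁ := ℝ) _ one_pos]
  refine BoundedContinuousFunction.arzela_ascoli (Metric.closedBall 0 ‖φ‖)
    (isCompact_closedBall _ _) _ ?_ ?_
  · rintro _ x ⟨f, hf, rfl⟩
    rw [mem_closedBall_zero_iff] at hf ⊢
    exact (norm_inner_le_norm _ _).trans
      ((mul_le_mul (φ.norm_coe_le_norm x) hf (norm_nonneg _) (norm_nonneg _)).trans_eq
        (mul_one _))
  · intro x₀
    refine Metric.equicontinuousAt_iff_right.2 fun ε hε => ?_
    filter_upwards [φ.continuous.continuousAt (Metric.ball_mem_nhds (φ x₀) hε)] with x hx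
    rintro ⟨_, f, hf, rfl⟩
    rw [mem_closedBall_zero_iff] at hf
    have hx' : ‖φ x₀ - φ x‖ < ε := by rwa [← dist_eq_norm, dist_comm]
    change dist (inner ℝ (φ x₀) f) (inner ℝ (φ x) f) < ε
    rw [dist_eq_norm, ← inner_sub_left]
    calc ‖inner ℝ (φ x₀ - φ x) f‖ ≤ ‖φ x₀ - φ x‖ * ‖f‖ := norm_inner_le_norm _ _
      _ ≤ ‖φ x₀ - φ x‖ * 1 := by gcongr
      _ < ε := by rwa [mul_one]

end FeatureMap

/-- The normalized indicator of a set. -/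
noncomputable def averagingFunction {S : Type*} [MeasurableSpace S] (μ : Measure S) [IsProbabilityMeasure μ] {U : Set S}
    (hU : MeasurableSet U) : Lp ℝ 2 μ :=
  (μ.real U)⁻¹ • indicatorConstLp 2 hU (measure_ne_top μ U) (1 : ℝ)

theorem abs_inner_averagingFunction_sub_le {S : Type*} [MeasurableSpace S] {μ : Measure S}
    [IsProbabilityMeasure μ] {U : Set S} (hU : MeasurableSet U) (hU0 : 0 < μ U)
    {f : Lp ℝ 2 μ} {h : S → ℝ} (hf : f =ᵐ[μ] h) {c η : ℝ} (hc : ∀ x ∈ U, |h x - c| ≤ η) :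
    |inner ℝ (averagingFunction μ hU) f - c| ≤ η := by
  have hU' : 0 < μ.real U := ENNReal.toReal_pos hU0.ne' (measure_ne_top μ U)
  have hint : Integrable f μ := (Lp.memLp f).integrable one_le_two
  have h1 : inner ℝ (averagingFunction μ hU) f - c = (μ.real U)⁻¹ * ∫ x in U, (f x - c) ∂μ := by
    rw [averagingFunction, real_inner_smul_left, L2.inner_indicatorConstLp_one,
      integral_sub hint.integrableOn (integrable_const c), setIntegral_const, smul_eq_mul]
    field_simp
  have h2 : ‖∫ x in U, (f x - c) ∂μ‖ ≤ η * μ.real U := by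
    refine norm_setIntegral_le_of_norm_le_const_ae' (measure_lt_top μ U) ?_
    filter_upwards [hf] with x hx hxU
    rw [hx]
    exact hc x hxU
  rw [h1, abs_mul, abs_of_pos (inv_pos.2 hU'), inv_mul_le_iff₀ hU']
  rw [Real.norm_eq_abs] at h2
  linarith

section IntegralOperator

variable {S : Type*} [MetricSpace S] [CompactSpace S] [MeasurableSpace S] [BorelSpace S]
  {μ : Measure S} [IsProbabilityMeasure μ] {W : S → S → ℝ}

/-- The sections `W(x, ·)` of a continuous kernel, as elements of `L²(μ)`. -/
noncomputable def kernelFeature (μ : Measure S) [IsProbabilityMeasure μ]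
    (hW : Continuous fun p : S × S => W p.1 p.2) : C(S, Lp ℝ 2 μ) :=
  ⟨fun x => ContinuousMap.toLp 2 μ ℝ (ContinuousMap.curry ⟨fun p : S × S => W p.1 p.2, hW⟩ x),
    (ContinuousMap.toLp 2 μ ℝ).continuous.comp (ContinuousMap.curry _).continuous⟩

/-- The integral operator of a continuous kernel on `L²(μ)`. -/
noncomputable def kernelOperator (μ : Measure S) [IsProbabilityMeasure μ]
    (hW : Continuous fun p : S × S => W p.1 p.2) : Lp ℝ 2 μ →L[ℝ] Lp ℝ 2 μ :=
  (BoundedContinuousFunction.toLp 2 μ ℝ).comp (evalFeature (kernelFeature μ hW))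

theorem evalFeature_kernelFeature (hW : Continuous fun p : S × S => W p.1 p.2) (f : Lp ℝ 2 μ)
    (x : S) : evalFeature (kernelFeature μ hW) f x = ∫ y, W x y * f y ∂μ := by
  rw [evalFeature_apply, L2.inner_def]
  have h := ContinuousMap.coeFn_toLp (p := 2) (𝕜 := ℝ) μ
    (ContinuousMap.curry ⟨fun p : S × S => W p.1 p.2, hW⟩ x)
  refine integral_congr_ae ?_
  filter_upwards [h] with y hy
  change inner ℝ ((ContinuousMap.toLp 2 μ ℝ _ : Lp ℝ 2 μ) y) (f y) = _
  rw [hy]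
  simp [mul_comm]

theorem kernelOperator_apply_ae (hW : Continuous fun p : S × S => W p.1 p.2) (f : Lp ℝ 2 μ) :
    kernelOperator μ hW f =ᵐ[μ] fun x => ∫ y, W x y * f y ∂μ := by
  filter_upwards [BoundedContinuousFunction.coeFn_toLp (p := 2) μ ℝ
    (evalFeature (kernelFeature μ hW) f)] with x hx
  rw [← evalFeature_kernelFeature hW]
  exact hx

theorem isCompactOperator_kernelOperator (hW : Continuous fun p : S × S => W p.1 p.2) :
    IsCompactOperator (kernelOperator μ hW) :=
  (isCompactOperator_evalFeature (kernelFeature μ hW)).clm_comp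
    (BoundedContinuousFunction.toLp 2 μ ℝ)

theorem kernelOperator_isSymmetric (hW : Continuous fun p : S × S => W p.1 p.2)
    (hs : ∀ x y, W x y = W y x) :
    (kernelOperator μ hW : Lp ℝ 2 μ →ₗ[ℝ] Lp ℝ 2 μ).IsSymmetric := by
  intro f g
  have hint : ∀ f : Lp ℝ 2 μ, Integrable f μ := fun f =>
    (Lp.memLp f).integrable one_le_two
  obtain ⟨B, hB⟩ := isCompact_univ.exists_bound_of_continuousOn hW.continuousOn
  have hprod : Integrable (Function.uncurry fun x y => W x y * (g x * f y)) (μ.prod μ) :=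
    ((hint g).mul_prod (hint f)).bdd_mul (c := B) hW.aestronglyMeasurable
      (Filter.Eventually.of_forall fun p => hB p (Set.mem_univ p))
  have h1 : inner ℝ (kernelOperator μ hW f) g = ∫ x, ∫ y, W x y * (g x * f y) ∂μ ∂μ := by
    rw [L2.inner_def]
    refine integral_congr_ae ?_
    filter_upwards [kernelOperator_apply_ae hW f] with x hx
    rw [hx]
    simp only [RCLike.inner_apply, conj_trivial]
    rw [← integral_const_mul]
    exact integral_congr_ae (Filter.Eventually.of_forall fun y => mul_left_comm _ _ _)
  have h2 : inner ℝ f (kernelOperator μ hW g) = ∫ y, ∫ x, W x y * (g x * f y) ∂μ ∂μ := by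
    rw [L2.inner_def]
    refine integral_congr_ae ?_
    filter_upwards [kernelOperator_apply_ae hW g] with y hy
    rw [hy]
    simp only [RCLike.inner_apply, conj_trivial]
    rw [← integral_mul_const]
    exact integral_congr_ae (Filter.Eventually.of_forall fun x => by
      change W y x * g x * f y = W x y * (g x * f y)
      rw [hs, mul_assoc])
  change inner ℝ (kernelOperator μ hW f) g = inner ℝ f (kernelOperator μ hW g)
  rw [h1, h2, integral_integral_swap hprod]

theorem inner_kernelOperator_nonneg (hW : IsConnectivityKernel μ W) (f : Lp ℝ 2 μ) :
    0 ≤ inner ℝ (kernelOperator μ hW.continuous f) f := by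
  refine inner_nonneg_of_isCompactOperator (isCompactOperator_kernelOperator hW.continuous)
    (kernelOperator_isSymmetric hW.continuous hW.symm) (fun l hl => ?_) f
  obtain ⟨g, hg⟩ := hl.exists_hasEigenvector
  refine (hW.eigenvalue_mem_Icc l ⟨g, Lp.memLp g, ?_, ?_⟩).1
  · intro h0
    exact hg.2 ((Lp.eq_zero_iff_ae_eq_zero).2 h0)
  · have h1 : kernelOperator μ hW.continuous g = l • g := hg.apply_eq_smul
    have h2 := kernelOperator_apply_ae hW.continuous g
    rw [h1] at h2
    filter_upwards [h2, Lp.coeFn_smul l g] with x hx hx'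
    rw [← hx, hx']
    rfl

theorem posSemidef_gramMatrix (hW : IsConnectivityKernel μ W) {n : ℕ} {x : Fin n → S}
    (hx : ∀ i, x i ∈ μ.support) : (gramMatrix W x).PosSemidef := by
  refine Matrix.PosSemidef.of_dotProduct_mulVec_nonneg ?_ fun a => ?_
  · ext i j
    simp [gramMatrix, hW.symm (x j) (x i)]
  have hform : star a ⬝ᵥ (gramMatrix W x).mulVec a = ∑ i, ∑ j, a i * a j * W (x i) (x j) := by
    simp only [dotProduct, Matrix.mulVec, gramMatrix, Matrix.of_apply, Finset.mul_sum, star_trivial]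
    exact Finset.sum_congr rfl fun i _ => Finset.sum_congr rfl fun j _ => by ring
  rw [hform]
  -- the form is approximated by the operator evaluated at averages over small balls
  set s : ℝ := ∑ i, ∑ j, |a i * a j| with hs
  have hs0 : 0 ≤ s := Finset.sum_nonneg fun i _ => Finset.sum_nonneg fun j _ => abs_nonneg _
  have key : ∀ η > 0, -(η * s) ≤ ∑ i, ∑ j, a i * a j * W (x i) (x j) := by
    intro η hη
    obtain ⟨δ, hδ, hunif⟩ := Metric.uniformContinuous_iff.1
      (CompactSpace.uniformContinuous_of_continuous hW.continuous) η hη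
    let U : Fin n → Set S := fun i => Metric.ball (x i) δ
    have hU : ∀ i, MeasurableSet (U i) := fun i => measurableSet_ball
    have hU0 : ∀ i, 0 < μ (U i) := fun i =>
      (Measure.mem_support_iff_forall (x i)).1 (hx i) _ (Metric.ball_mem_nhds _ hδ)
    let g : Fin n → Lp ℝ 2 μ := fun i => averagingFunction μ (hU i)
    have hg : ∀ i j, |inner ℝ (g i) (kernelOperator μ hW.continuous (g j)) - W (x i) (x j)| ≤ η := by
      intro i j
      refine abs_inner_averagingFunction_sub_le (hU i) (hU0 i)
        (BoundedContinuousFunction.coeFn_toLp (p := 2) μ ℝ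
          (evalFeature (kernelFeature μ hW.continuous) (g j))) fun y hy => ?_
      rw [evalFeature_apply, real_inner_comm]
      refine abs_inner_averagingFunction_sub_le (hU j) (hU0 j)
        (ContinuousMap.coeFn_toLp (p := 2) (𝕜 := ℝ) μ _) fun z hz => ?_
      have := hunif (a := (y, z)) (b := (x i, x j)) (by
        rw [Prod.dist_eq]
        exact max_lt hy hz)
      exact this.le
    have hpos := inner_kernelOperator_nonneg hW (∑ i, a i • g i)
    have hexp : inner ℝ (kernelOperator μ hW.continuous (∑ i, a i • g i)) (∑ i, a i • g i) =
        ∑ i, ∑ j, a i * a j * inner ℝ (g i) (kernelOperator μ hW.continuous (g j)) := by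
      rw [real_inner_comm, map_sum, sum_inner]
      refine Finset.sum_congr rfl fun i _ => ?_
      rw [inner_sum]
      refine Finset.sum_congr rfl fun j _ => ?_
      rw [map_smul, real_inner_smul_left, real_inner_smul_right, mul_assoc]
    rw [hexp] at hpos
    have hdiff : ∑ i, ∑ j, a i * a j * inner ℝ (g i) (kernelOperator μ hW.continuous (g j)) -
        ∑ i, ∑ j, a i * a j * W (x i) (x j) ≤ η * s := by
      rw [hs, ← Finset.sum_sub_distrib, Finset.mul_sum]
      refine Finset.sum_le_sum fun i _ => ?_
      rw [← Finset.sum_sub_distrib, Finset.mul_sum]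
      refine Finset.sum_le_sum fun j _ => ?_
      rw [← mul_sub]
      refine (le_abs_self _).trans ?_
      rw [abs_mul, mul_comm]
      exact mul_le_mul_of_nonneg_right (hg i j) (abs_nonneg _)
    linarith
  refine le_of_forall_pos_le_add fun ε hε => ?_
  have h := key (ε / (s + 1)) (by positivity)
  have h2 : ε / (s + 1) * s ≤ ε := by
    rw [div_mul_eq_mul_div, div_le_iff₀ (by positivity)]
    nlinarith
  linarith

theorem ae_posSemidef_gramMatrix (hW : IsConnectivityKernel μ W) {Ω : Type*} [MeasurableSpace Ω]
    {P : Measure Ω} {n : ℕ} {X : Fin n → Ω → S} (hX : ∀ i, Measurable (X i))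
    (hlaw : ∀ i, P.map (X i) = μ) : ∀ᵐ ω ∂P, (gramMatrix W fun i => X i ω).PosSemidef := by
  have h : ∀ i, ∀ᵐ ω ∂P, X i ω ∈ μ.support := by
    intro i
    have h1 : ∀ᵐ x ∂(P.map (X i)), x ∈ μ.support := by
      rw [hlaw i]
      exact Measure.support_mem_ae
    exact ae_of_ae_map (hX i).aemeasurable h1
  filter_upwards [ae_all_iff.2 h] with ω hω
  exact posSemidef_gramMatrix hW hω

end IntegralOperator

/-! ### The thresholded matrix -/

open scoped Matrix.Norms.Frobenius in
theorem frobeniusNorm_add_le {n : ℕ} (M N : Matrix (Fin n) (Fin n) ℝ) :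
    frobeniusNorm (M + N) ≤ frobeniusNorm M + frobeniusNorm N :=
  norm_add_le M N

open scoped Matrix.Norms.Frobenius in
theorem frobeniusNorm_smul {n : ℕ} (a : ℝ) (M : Matrix (Fin n) (Fin n) ℝ) :
    frobeniusNorm (a • M) = |a| * frobeniusNorm M :=
  norm_smul a M

theorem frobeniusNorm_one {n : ℕ} :
    frobeniusNorm (1 : Matrix (Fin n) (Fin n) ℝ) = Real.sqrt n := by
  rw [frobeniusNorm_eq]
  simp [Matrix.one_apply]

theorem sum_sq_eq_trace {V : Type*} [Fintype V] (M : Matrix V V ℝ) :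
    ∑ i, ∑ j, M i j ^ 2 = (M * M.transpose).trace := by
  simp [Matrix.trace, Matrix.mul_apply, sq]

theorem sum_sq_conj {V : Type*} [Fintype V] [DecidableEq V] {U : Matrix V V ℝ}
    (hU : U.transpose * U = 1) (M : Matrix V V ℝ) :
    ∑ i, ∑ j, (U * M * U.transpose) i j ^ 2 = ∑ i, ∑ j, M i j ^ 2 := by
  rw [sum_sq_eq_trace, sum_sq_eq_trace]
  have h : (U * M * U.transpose) * (U * M * U.transpose).transpose =
      U * (M * M.transpose) * U.transpose := by
    rw [Matrix.transpose_mul, Matrix.transpose_mul, Matrix.transpose_transpose]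
    calc U * M * U.transpose * (U * (M.transpose * U.transpose))
        = U * M * (U.transpose * U) * M.transpose * U.transpose := by simp only [Matrix.mul_assoc]
      _ = _ := by rw [hU, Matrix.mul_one]; simp only [Matrix.mul_assoc]
  rw [h, Matrix.trace_mul_cycle, hU, Matrix.one_mul]

/-- The eigenvalues that survive thresholding at level `γ`. -/
noncomputable def thresholded {V : Type*} (γ : ℝ) (l : V → ℝ) (i : V) : ℝ := if γ ≤ l i then l i else 0

theorem thresholded_nonneg {V : Type*} {γ : ℝ} (hγ : 0 ≤ γ) (l : V → ℝ) (i : V) : 0 ≤ thresholded γ l i := by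
  unfold thresholded
  split_ifs with h
  · exact hγ.trans h
  · exact le_rfl

section Threshold

variable {V : Type*} [Fintype V] [DecidableEq V]

theorem abs_eigenvalues_le_of_posSemidef {H : Matrix V V ℝ} (hH : H.IsHermitian) {E : ℝ}
    (hE : 0 ≤ E) (h : (E ^ 2 • (1 : Matrix V V ℝ) - H * H).PosSemidef) (i : V) :
    |hH.eigenvalues i| ≤ E := by
  refine abs_le_of_sq_le_sq ?_ hE
  set v : V → ℝ := ⇑(hH.eigenvectorBasis i) with hv
  have hvv : v ⬝ᵥ v = 1 := by
    rw [← sum_sq_eigenvectorBasis hH i]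
    simp [dotProduct, sq, hv]
  have hHv : H.mulVec v = hH.eigenvalues i • v := hH.mulVec_eigenvectorBasis i
  have h1 := h.dotProduct_mulVec_nonneg v
  rw [star_trivial, Matrix.sub_mulVec, Matrix.smul_mulVec, Matrix.one_mulVec,
    ← Matrix.mulVec_mulVec, hHv, Matrix.mulVec_smul, hHv, dotProduct_sub, dotProduct_smul,
    dotProduct_smul, dotProduct_smul, hvv] at h1
  simp only [smul_eq_mul, mul_one] at h1
  linarith

/-- A positive semidefinite matrix of spectral norm at most `L` has squared Frobenius norm at most
`L` times its trace. -/
theorem sum_sq_le_mul_trace {R : Matrix V V ℝ} (hR : R.PosSemidef) {L : ℝ}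
    (hL : ∀ x : V → ℝ, x ⬝ᵥ R.mulVec x ≤ L * ∑ i, x i ^ 2) :
    ∑ i, ∑ j, R i j ^ 2 ≤ L * R.trace := by
  have hRt : R.transpose = R := by simpa [Matrix.IsHermitian] using hR.isHermitian
  have htr : R.trace = ∑ i, hR.isHermitian.eigenvalues i := by
    simpa using trace_pow_eq_sum_eigenvalues_pow hR.isHermitian 1
  rw [sum_sq_eq_trace, hRt, ← sq, trace_pow_eq_sum_eigenvalues_pow hR.isHermitian, htr,
    Finset.mul_sum]
  refine Finset.sum_le_sum fun i _ => ?_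
  have h0 : 0 ≤ hR.isHermitian.eigenvalues i := hR.eigenvalues_nonneg i
  have h1 := hL ⇑(hR.isHermitian.eigenvectorBasis i)
  rw [hR.isHermitian.mulVec_eigenvectorBasis, dotProduct_smul, sum_sq_eigenvectorBasis] at h1
  have h2 : ⇑(hR.isHermitian.eigenvectorBasis i) ⬝ᵥ ⇑(hR.isHermitian.eigenvectorBasis i) = 1 := by
    rw [← sum_sq_eigenvectorBasis hR.isHermitian i]
    simp [dotProduct, sq]
  rw [h2, smul_eq_mul, mul_one, mul_one] at h1
  rw [sq]
  exact mul_le_mul_of_nonneg_right h1 h0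

variable {N : Matrix V V ℝ} {l : V → ℝ} {E γ : ℝ}

theorem sum_sq_column_le {H : Matrix V V ℝ} (hH : H.IsHermitian)
    (h : (E ^ 2 • (1 : Matrix V V ℝ) - H * H).PosSemidef) (j : V) : ∑ i, H i j ^ 2 ≤ E ^ 2 := by
  have h1 := h.diag_nonneg (i := j)
  have hs : ∀ i, H j i = H i j := fun i => by simpa using hH.apply i j
  simp only [Matrix.sub_apply, Matrix.smul_apply, Matrix.one_apply_eq, smul_eq_mul, mul_one,
    Matrix.mul_apply, hs] at h1
  simp only [sq (H _ _)]
  linarith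

theorem abs_diag_le {H : Matrix V V ℝ} (hH : H.IsHermitian) (hE : 0 ≤ E)
    (h : (E ^ 2 • (1 : Matrix V V ℝ) - H * H).PosSemidef) (j : V) : |H j j| ≤ E := by
  refine abs_le_of_sq_le_sq ?_ hE
  exact (Finset.single_le_sum (f := fun i => H i j ^ 2) (fun _ _ => sq_nonneg _)
    (Finset.mem_univ j)).trans (sum_sq_column_le hH h j)

/-- Few eigenvalues survive thresholding: each of them comes with a diagonal entry of `N` of size at
least `γ / 2`. -/
theorem card_mul_threshold_le (hN : N.PosSemidef) (hE : 0 ≤ E) (hEγ : 2 * E ≤ γ)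
    (h : (E ^ 2 • (1 : Matrix V V ℝ) -
      (Matrix.diagonal l - N) * (Matrix.diagonal l - N)).PosSemidef) :
    ((Finset.univ.filter fun i => γ ≤ l i).card : ℝ) * γ ≤ 2 * N.trace := by
  have hH : (Matrix.diagonal l - N).IsHermitian :=
    (Matrix.isHermitian_diagonal l).sub hN.isHermitian
  have h1 : ∀ i ∈ Finset.univ.filter (fun i => γ ≤ l i), γ / 2 ≤ N i i := by
    intro i hi
    have hi := (Finset.mem_filter.1 hi).2
    have h2 := le_of_abs_le (abs_diag_le hH hE h i)
    rw [Matrix.sub_apply, Matrix.diagonal_apply_eq] at h2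
    linarith
  have h3 : ((Finset.univ.filter fun i => γ ≤ l i).card : ℝ) * (γ / 2) ≤ N.trace := by
    rw [← nsmul_eq_mul, ← Finset.sum_const]
    refine (Finset.sum_le_sum h1).trans ?_
    exact Finset.sum_le_sum_of_subset_of_nonneg (Finset.filter_subset _ _)
      fun i _ _ => hN.diag_nonneg
  linarith

theorem thresholded_le (hN : N.PosSemidef) (hE : 0 ≤ E)
    (h : (E ^ 2 • (1 : Matrix V V ℝ) -
      (Matrix.diagonal l - N) * (Matrix.diagonal l - N)).PosSemidef) (i : V) :
    thresholded γ l i ≤ N.trace + E := by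
  have hH : (Matrix.diagonal l - N).IsHermitian :=
    (Matrix.isHermitian_diagonal l).sub hN.isHermitian
  have h1 : N i i ≤ N.trace :=
    Finset.single_le_sum (f := fun i => N i i) (fun i _ => hN.diag_nonneg) (Finset.mem_univ i)
  unfold thresholded
  split_ifs
  · have h2 := le_of_abs_le (abs_diag_le hH hE h i)
    rw [Matrix.sub_apply, Matrix.diagonal_apply_eq] at h2
    linarith
  · exact add_nonneg hN.trace_nonneg hE

theorem sum_thresholded_le (hN : N.PosSemidef) (hE : 0 ≤ E) (hγ : 0 < γ) (hEγ : 2 * E ≤ γ)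
    (h : (E ^ 2 • (1 : Matrix V V ℝ) -
      (Matrix.diagonal l - N) * (Matrix.diagonal l - N)).PosSemidef) :
    ∑ i, thresholded γ l i ≤ N.trace * (1 + 2 * E / γ) := by
  have hH : (Matrix.diagonal l - N).IsHermitian :=
    (Matrix.isHermitian_diagonal l).sub hN.isHermitian
  have h1 : ∑ i, thresholded γ l i ≤
      N.trace + ((Finset.univ.filter fun i => γ ≤ l i).card : ℝ) * E := by
    rw [← nsmul_eq_mul, ← Finset.sum_const, Finset.sum_filter, Matrix.trace,
      ← Finset.sum_add_distrib]
    refine Finset.sum_le_sum fun i _ => ?_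
    unfold thresholded
    split_ifs
    · have h2 := le_of_abs_le (abs_diag_le hH hE h i)
      rw [Matrix.sub_apply, Matrix.diagonal_apply_eq] at h2
      rw [Matrix.diag_apply]
      linarith
    · rw [add_zero]
      exact hN.diag_nonneg
  have h2 := card_mul_threshold_le hN hE hEγ h
  have h3 : ((Finset.univ.filter fun i => γ ≤ l i).card : ℝ) * E ≤ 2 * N.trace * (E / γ) := by
    have := mul_le_mul_of_nonneg_right h2 (div_nonneg hE hγ.le)
    refine le_trans (le_of_eq ?_) this
    field_simp
  calc _ ≤ _ := h1
    _ ≤ N.trace + 2 * N.trace * (E / γ) := by linarith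
    _ = _ := by ring

/-- The Frobenius error of spectral thresholding. The block of discarded indices has spectral norm
at most `γ + E`, and the remaining entries lie in few rows and columns, in which the thresholded
matrix coincides with the observed one. -/
theorem sum_sq_thresholded_sub_le (hN : N.PosSemidef) (hE : 0 ≤ E) (hγ : 0 < γ) (hEγ : 2 * E ≤ γ)
    (h : (E ^ 2 • (1 : Matrix V V ℝ) -
      (Matrix.diagonal l - N) * (Matrix.diagonal l - N)).PosSemidef) :
    ∑ i, ∑ j, (Matrix.diagonal (thresholded γ l) - N) i j ^ 2 ≤ 3 * γ * N.trace := by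
  set H := Matrix.diagonal l - N with hHdef
  have hH : H.IsHermitian := (Matrix.isHermitian_diagonal l).sub hN.isHermitian
  set G := Matrix.diagonal (thresholded γ l) - N with hG
  have hGs : ∀ i j, G i j = G j i := fun i j => by
    have : G.IsHermitian := (Matrix.isHermitian_diagonal _).sub hN.isHermitian
    simpa using this.apply j i
  set q : V → ℝ := fun i => if γ ≤ l i then 0 else 1 with hq
  set R := Matrix.diagonal q * N * Matrix.diagonal q with hR
  have hRij : ∀ i j, R i j = q i * N i j * q j := fun i j => by
    rw [hR, Matrix.mul_diagonal, Matrix.diagonal_mul]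
  have hRpos : R.PosSemidef := by
    have := hN.mul_mul_conjTranspose_same (Matrix.diagonal q)
    rwa [Matrix.conjTranspose_eq_transpose_of_trivial, Matrix.diagonal_transpose] at this
  have hJ : ∀ j, γ ≤ l j → ∀ i, G i j = H i j := by
    intro j hj i
    rw [hG, hHdef, Matrix.sub_apply, Matrix.sub_apply, Matrix.diagonal_apply, Matrix.diagonal_apply]
    split_ifs with hij
    · rw [thresholded, hij, if_pos hj]
    · rfl
  have hJc : ∀ i j, ¬ γ ≤ l i → ¬ γ ≤ l j → G i j = - R i j := by
    intro i j hi hj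
    rw [hRij, hG, Matrix.sub_apply, Matrix.diagonal_apply]
    simp [hq, hi, hj, thresholded]
  -- each entry is charged to its column, to its row, or to the block of discarded indices
  have hentry : ∀ i j, G i j ^ 2 ≤ (if γ ≤ l j then H i j ^ 2 else 0) +
      (if γ ≤ l i then H j i ^ 2 else 0) + R i j ^ 2 := by
    intro i j
    by_cases hj : γ ≤ l j
    · rw [if_pos hj, hJ j hj]
      have : 0 ≤ (if γ ≤ l i then H j i ^ 2 else 0) := by split_ifs <;> positivity
      nlinarith [sq_nonneg (R i j)]
    · by_cases hi : γ ≤ l i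
      · rw [if_neg hj, if_pos hi, hGs, hJ i hi]
        nlinarith [sq_nonneg (R i j)]
      · rw [if_neg hj, if_neg hi, hJc i j hi hj, neg_sq]
        simp
  have hcol : ∑ j, ∑ i, (if γ ≤ l j then H i j ^ 2 else 0) ≤
      ((Finset.univ.filter fun i => γ ≤ l i).card : ℝ) * E ^ 2 := by
    rw [← nsmul_eq_mul, ← Finset.sum_const, Finset.sum_filter]
    refine Finset.sum_le_sum fun j _ => ?_
    split_ifs
    · exact sum_sq_column_le hH h j
    · simp
  have hblock : ∑ i, ∑ j, R i j ^ 2 ≤ (γ + E) * N.trace := by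
    refine (sum_sq_le_mul_trace hRpos (L := γ + E) fun x => ?_).trans ?_
    · set y : V → ℝ := fun i => q i * x i with hy
      have hy2 : ∑ i, y i ^ 2 ≤ ∑ i, x i ^ 2 := by
        refine Finset.sum_le_sum fun i _ => ?_
        simp only [hy, hq]
        split_ifs <;> nlinarith [sq_nonneg (x i)]
      have hRx : x ⬝ᵥ R.mulVec x = y ⬝ᵥ N.mulVec y := by
        simp only [dotProduct, Matrix.mulVec, hRij, hy, Finset.mul_sum]
        exact Finset.sum_congr rfl fun i _ => Finset.sum_congr rfl fun j _ => by ring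
      have hNy : y ⬝ᵥ N.mulVec y = ∑ i, l i * y i ^ 2 - y ⬝ᵥ H.mulVec y := by
        rw [hHdef, Matrix.sub_mulVec, dotProduct_sub]
        have : y ⬝ᵥ (Matrix.diagonal l).mulVec y = ∑ i, l i * y i ^ 2 := by
          simp only [dotProduct, Matrix.mulVec_diagonal]
          exact Finset.sum_congr rfl fun i _ => by ring
        rw [this]
        ring
      have hly : ∑ i, l i * y i ^ 2 ≤ γ * ∑ i, y i ^ 2 := by
        rw [Finset.mul_sum]
        refine Finset.sum_le_sum fun i _ => ?_
        by_cases hi : γ ≤ l i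
        · simp [hy, hq, hi]
        · exact mul_le_mul_of_nonneg_right (not_le.1 hi).le (sq_nonneg _)
      have hHy := neg_le_of_abs_le (abs_dotProduct_mulVec_le hH
        (abs_eigenvalues_le_of_posSemidef hH hE h) y)
      rw [hRx, hNy]
      have : (γ + E) * ∑ i, y i ^ 2 ≤ (γ + E) * ∑ i, x i ^ 2 :=
        mul_le_mul_of_nonneg_left hy2 (by linarith)
      linarith
    · refine mul_le_mul_of_nonneg_left (Finset.sum_le_sum fun i _ => ?_) (by linarith)
      have h0 : 0 ≤ N i i := hN.diag_nonneg
      rw [Matrix.diag_apply, Matrix.diag_apply, hRij]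
      simp only [hq]
      split_ifs <;> linarith
  have hcard := card_mul_threshold_le hN hE hEγ h
  have hE2 : ((Finset.univ.filter fun i => γ ≤ l i).card : ℝ) * E ^ 2 ≤ N.trace * E := by
    have h1 := mul_le_mul_of_nonneg_right hcard hE
    have h2 : ((Finset.univ.filter fun i => γ ≤ l i).card : ℝ) * (2 * E) ≤
        ((Finset.univ.filter fun i => γ ≤ l i).card : ℝ) * γ :=
      mul_le_mul_of_nonneg_left hEγ (Nat.cast_nonneg _)
    have h3 := mul_le_mul_of_nonneg_right h2 hE
    nlinarith
  have hNtr : 0 ≤ N.trace := hN.trace_nonneg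
  calc ∑ i, ∑ j, G i j ^ 2
      ≤ ∑ i, ∑ j, ((if γ ≤ l j then H i j ^ 2 else 0) +
          (if γ ≤ l i then H j i ^ 2 else 0) + R i j ^ 2) :=
        Finset.sum_le_sum fun i _ => Finset.sum_le_sum fun j _ => hentry i j
    _ = ∑ j, ∑ i, (if γ ≤ l j then H i j ^ 2 else 0) +
          ∑ i, ∑ j, (if γ ≤ l i then H j i ^ 2 else 0) + ∑ i, ∑ j, R i j ^ 2 := by
        simp only [Finset.sum_add_distrib]
        rw [Finset.sum_comm]
    _ ≤ N.trace * E + N.trace * E + (γ + E) * N.trace := by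
        gcongr
        · exact hcol.trans hE2
        · exact hcol.trans hE2
    _ ≤ 3 * γ * N.trace := by nlinarith

end Threshold

/-! ### Error of the estimator on the concentration event -/

section Estimator

variable {n : ℕ} {A : Matrix (Fin n) (Fin n) ℝ} {α c γ : ℝ}

theorem usvtEstimator_eq (α γ : ℝ) (hA : A.IsHermitian) :
    usvtEstimator α γ A hA = eigenMatrix hA *
      Matrix.diagonal (fun i => thresholded γ hA.eigenvalues i / α) *
      (eigenMatrix hA).transpose := by
  ext a b
  rw [usvtEstimator, Matrix.smul_apply, Matrix.sum_apply, Matrix.mul_apply, Finset.sum_filter,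
    smul_eq_mul, Finset.mul_sum]
  refine Finset.sum_congr rfl fun i _ => ?_
  have hU : ∀ a, eigenMatrix hA a i = hA.eigenvectorBasis i a := fun a => rfl
  rw [Matrix.mul_diagonal, Matrix.transpose_apply, hU, hU, thresholded]
  split_ifs
  · rw [Matrix.smul_apply, Matrix.vecMulVec_apply, smul_eq_mul]
    ring
  · simp

theorem trace_conj_diagonal {U : Matrix (Fin n) (Fin n) ℝ} (hU : U.transpose * U = 1)
    (f : Fin n → ℝ) : (U * Matrix.diagonal f * U.transpose).trace = ∑ i, f i := by
  rw [Matrix.trace_mul_cycle, hU, Matrix.one_mul, Matrix.trace_diagonal]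

theorem lambdaMax_conj_diagonal {U : Matrix (Fin n) (Fin n) ℝ} (hU : U.transpose * U = 1)
    (f : Fin n → ℝ) :
    lambdaMax (U * Matrix.diagonal f * U.transpose) = sSup (Set.range f) := by
  let u : (Matrix (Fin n) (Fin n) ℝ)ˣ := ⟨U, U.transpose, mul_eq_one_comm.1 hU, hU⟩
  have h := spectrum.units_conjugate (R := ℝ) (a := Matrix.diagonal f) (u := u)
  rw [lambdaMax]
  change sSup (spectrum ℝ ((u : Matrix (Fin n) (Fin n) ℝ) * Matrix.diagonal f *
    ((u⁻¹ : (Matrix (Fin n) (Fin n) ℝ)ˣ) : Matrix (Fin n) (Fin n) ℝ))) = _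
  rw [h, spectrum_diagonal]

theorem traceCorrection_conj_diagonal {U : Matrix (Fin n) (Fin n) ℝ} (hU : U.transpose * U = 1)
    (c : ℝ) (f : Fin n → ℝ) :
    traceCorrection c (U * Matrix.diagonal f * U.transpose) =
      U * Matrix.diagonal (fun i => f i + max (c - (∑ i, f i) / n) 0) * U.transpose := by
  have h : Matrix.diagonal (fun i => f i + max (c - (∑ i, f i) / n) 0) =
      Matrix.diagonal f + max (c - (∑ i, f i) / n) 0 • (1 : Matrix (Fin n) (Fin n) ℝ) := by
    rw [← Matrix.diagonal_one, ← Matrix.diagonal_smul, Matrix.diagonal_add]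
    congr 1
    ext i
    simp
  rw [traceCorrection, trace_conj_diagonal hU, h, Matrix.mul_add, Matrix.add_mul, Matrix.mul_smul,
    Matrix.smul_mul, Matrix.mul_one, mul_eq_one_comm.1 hU]

/-- The spectral rescaling of a positive semidefinite matrix of spectral norm at most `n (1 + η)` is
a multiplication by a number close to one. If the matrix vanishes, then that number is arbitrary. -/
theorem exists_spectralRescaling_eq {U : Matrix (Fin n) (Fin n) ℝ} (hU : U.transpose * U = 1)
    (hn : 0 < n) (hα : 0 < α) {f : Fin n → ℝ} (hf0 : ∀ i, 0 ≤ f i) {η : ℝ} (hη : 0 ≤ η)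
    (hf : ∀ i, f i ≤ n * (1 + η)) :
    ∃ s : ℝ, 0 ≤ s ∧ s ≤ 1 ∧ 1 - s ≤ η + 1 / (α * n) ^ (1 / 4 : ℝ) ∧
      spectralRescaling α (U * Matrix.diagonal f * U.transpose) =
        s • (U * Matrix.diagonal f * U.transpose) := by
  have hn' : (0 : ℝ) < n := by exact_mod_cast hn
  set t : ℝ := 1 / (α * n) ^ (1 / 4 : ℝ) with ht
  have ht0 : 0 ≤ t := by positivity
  by_cases hz : ∀ i, f i = 0
  · refine ⟨1, zero_le_one, le_rfl, by linarith, ?_⟩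
    have : Matrix.diagonal f = 0 := by
      rw [show f = 0 from funext hz]
      exact Matrix.diagonal_zero
    simp [spectralRescaling, this]
  push Not at hz
  obtain ⟨i, hi⟩ := hz
  have hfi : 0 < f i := lt_of_le_of_ne (hf0 i) (Ne.symm hi)
  have hbdd : BddAbove (Set.range f) := (Set.finite_range f).bddAbove
  have hpos : 0 < sSup (Set.range f) := hfi.trans_le (le_csSup hbdd ⟨i, rfl⟩)
  have hle : sSup (Set.range f) ≤ n * (1 + η) := by
    refine csSup_le ⟨f i, i, rfl⟩ ?_
    rintro _ ⟨j, rfl⟩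
    exact hf j
  have h1 : 1 - η ≤ n / sSup (Set.range f) := by
    rw [le_div_iff₀ hpos]
    rcases le_or_gt 1 η with h | h
    · nlinarith
    · nlinarith [mul_le_mul_of_nonneg_left hle (by linarith : 0 ≤ 1 - η), sq_nonneg η]
  have h2 : 1 - t ≤ (1 + t)⁻¹ := by
    rw [inv_eq_one_div, le_div_iff₀ (by positivity)]
    nlinarith [sq_nonneg t]
  refine ⟨min (n / sSup (Set.range f)) (1 + t)⁻¹, ?_, ?_, ?_, ?_⟩
  · exact le_min (div_nonneg hn'.le hpos.le) (by positivity)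
  · exact (min_le_right _ _).trans (inv_le_one_of_one_le₀ (by linarith))
  · have : 1 - (η + t) ≤ min (n / sSup (Set.range f)) (1 + t)⁻¹ :=
      le_min (by linarith) (by linarith)
    linarith
  · rw [spectralRescaling, lambdaMax_conj_diagonal hU]

/-- The error of the estimator when the adjacency matrix is within `E` of `α K` in spectral norm, in
terms of the threshold `γ` and of the average degree `α n`. -/
theorem usvtKernel_error_le (hn : 0 < n) (hα0 : 0 < α) (hα1 : α ≤ 1)
    {K : Matrix (Fin n) (Fin n) ℝ} (hK : K.PosSemidef) (hK1 : ∀ i j, |K i j| ≤ 1)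
    (hKc : ∀ i, K i i = c) (hA : A.IsHermitian) {E : ℝ} (hE : 0 ≤ E) (hγ : 0 < γ)
    (hEγ : 2 * E ≤ γ)
    (h : (E ^ 2 • (1 : Matrix (Fin n) (Fin n) ℝ) - (A - α • K) * (A - α • K)).PosSemidef) :
    max (frobeniusNorm ((1 / (n : ℝ)) • (usvtKernel α c γ A hA - K)))
      |((1 / (n : ℝ)) • usvtKernel α c γ A hA).trace - ((1 / (n : ℝ)) • K).trace| ≤
      2 * (Real.sqrt (3 * γ / (α * n)) + 1 / Real.sqrt (α * n)) + 2 * E / γ +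
        (E / (α * n) + 1 / (α * n) + 1 / (α * n) ^ (1 / 4 : ℝ)) := by
  have hn' : (0 : ℝ) < n := by exact_mod_cast hn
  set D : ℝ := α * n with hD
  have hD0 : 0 < D := by positivity
  have hDn : D ≤ n := mul_le_of_le_one_left hn'.le hα1
  have hc0 : 0 ≤ c := by rw [← hKc ⟨0, hn⟩]; exact hK.diag_nonneg
  have hc1 : c ≤ 1 := by rw [← hKc ⟨0, hn⟩]; exact le_of_abs_le (hK1 _ _)
  have hKtr : K.trace = n * c := by simp [Matrix.trace, hKc]
  set U := eigenMatrix hA with hUdef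
  have hU : U.transpose * U = 1 := eigenMatrix_transpose_mul_self hA
  have hU' : U * U.transpose = 1 := eigenMatrix_mul_transpose_self hA
  set l := hA.eigenvalues with hl
  -- the connection probabilities in the eigenbasis of the adjacency matrix
  set N : Matrix (Fin n) (Fin n) ℝ := U.transpose * (α • K) * U with hN
  have hNpos : N.PosSemidef := by
    have := (hK.smul hα0.le).conjTranspose_mul_mul_same U
    rwa [Matrix.conjTranspose_eq_transpose_of_trivial] at this
  have hNtr : N.trace = D * c := by
    rw [hN, Matrix.trace_mul_cycle, hU', Matrix.one_mul, Matrix.trace_smul, hKtr, hD, smul_eq_mul]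
    ring
  have hUN : U * N * U.transpose = α • K := by
    calc U * N * U.transpose = (U * U.transpose) * (α • K) * (U * U.transpose) := by
          rw [hN]; simp only [Matrix.mul_assoc]
      _ = α • K := by rw [hU', Matrix.one_mul, Matrix.mul_one]
  have hdiag : Matrix.diagonal l = U.transpose * A * U := by
    have hA' : A = U * Matrix.diagonal l * U.transpose := eq_eigenMatrix_mul hA
    calc Matrix.diagonal l = (U.transpose * U) * Matrix.diagonal l * (U.transpose * U) := by
          rw [hU, Matrix.one_mul, Matrix.mul_one]
      _ = U.transpose * (U * Matrix.diagonal l * U.transpose) * U := by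
          simp only [Matrix.mul_assoc]
      _ = U.transpose * A * U := congrArg (fun B => U.transpose * B * U) hA'.symm
  have hNE : (E ^ 2 • (1 : Matrix (Fin n) (Fin n) ℝ) -
      (Matrix.diagonal l - N) * (Matrix.diagonal l - N)).PosSemidef := by
    have h1 := h.conjTranspose_mul_mul_same U
    rw [Matrix.conjTranspose_eq_transpose_of_trivial] at h1
    have h2 : Matrix.diagonal l - N = U.transpose * (A - α • K) * U := by
      rw [hdiag, hN, Matrix.mul_sub, Matrix.sub_mul]
    have h3 : (U.transpose * (A - α • K) * U) * (U.transpose * (A - α • K) * U) =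
        U.transpose * ((A - α • K) * (A - α • K)) * U := by
      calc _ = U.transpose * (A - α • K) * (U * U.transpose) * (A - α • K) * U := by
            simp only [Matrix.mul_assoc]
        _ = _ := by rw [hU', Matrix.mul_one]; simp only [Matrix.mul_assoc]
    rw [Matrix.mul_sub, Matrix.sub_mul, Matrix.mul_smul, Matrix.mul_one, Matrix.smul_mul, hU,
      ← h3, ← h2] at h1
    exact h1
  set g : Fin n → ℝ := thresholded γ l with hg
  have hg0 : ∀ i, 0 ≤ g i := thresholded_nonneg hγ.le l
  set T : Matrix (Fin n) (Fin n) ℝ := U * Matrix.diagonal (fun i => g i / α) * U.transpose with hT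
  have hTeq : usvtEstimator α γ A hA = T := usvtEstimator_eq α γ hA
  -- the Frobenius error before the trace correction
  have hTK : frobeniusNorm (T - K) ≤ n * Real.sqrt (3 * γ / D) := by
    have h1 : T - K = (1 / α) • (U * (Matrix.diagonal g - N) * U.transpose) := by
      have h2 : Matrix.diagonal (fun i => g i / α) = (1 / α) • Matrix.diagonal g := by
        rw [← Matrix.diagonal_smul]
        congr 1
        ext i
        simp [div_eq_inv_mul]
      rw [Matrix.mul_sub, Matrix.sub_mul, hUN, smul_sub, smul_smul, one_div_mul_cancel hα0.ne',
        one_smul, hT, h2, Matrix.mul_smul, Matrix.smul_mul]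
    rw [h1, frobeniusNorm_smul, frobeniusNorm_eq, sum_sq_conj hU, abs_of_pos (by positivity)]
    have h2 := sum_sq_thresholded_sub_le hNpos hE hγ hEγ hNE
    rw [hNtr] at h2
    have h3 : ∑ i, ∑ j, (Matrix.diagonal g - N) i j ^ 2 ≤ 3 * γ * D :=
      h2.trans (mul_le_mul_of_nonneg_left (mul_le_of_le_one_right hD0.le hc1) (by positivity))
    have h4 : 3 * γ * D = D ^ 2 * (3 * γ / D) := by field_simp
    have h5 := Real.sqrt_le_sqrt h3
    rw [h4, Real.sqrt_mul (sq_nonneg D), Real.sqrt_sq hD0.le] at h5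
    calc 1 / α * Real.sqrt (∑ i, ∑ j, (Matrix.diagonal g - N) i j ^ 2)
        ≤ 1 / α * (D * Real.sqrt (3 * γ / D)) := mul_le_mul_of_nonneg_left h5 (by positivity)
      _ = n * Real.sqrt (3 * γ / D) := by rw [hD]; field_simp
  -- the trace correction
  set m : ℝ := (∑ i, g i / α) / n with hm
  have hm0 : 0 ≤ m := div_nonneg (Finset.sum_nonneg fun i _ => div_nonneg (hg0 i) hα0.le) hn'.le
  have hmc : m ≤ c + 2 * E / γ := by
    have h1 := sum_thresholded_le hNpos hE hγ hEγ hNE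
    rw [hNtr] at h1
    have h2 : m = (∑ i, g i) / D := by
      rw [hm, ← Finset.sum_div, hD]
      field_simp
    rw [h2, div_le_iff₀ hD0]
    have h3 : c * (2 * E / γ) ≤ 2 * E / γ := mul_le_of_le_one_left (by positivity) hc1
    nlinarith
  set τ : ℝ := max (c - m) 0 with hτ
  have hτ0 : 0 ≤ τ := le_max_right _ _
  have hτ1 : τ ≤ 1 := max_le (by linarith) zero_le_one
  have hmτ1 : c ≤ m + τ := by have := le_max_left (c - m) 0; linarith
  have hmτ2 : m + τ ≤ c + 2 * E / γ := by
    have h1 : 0 ≤ 2 * E / γ := by positivity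
    rcases max_choice (c - m) 0 with h2 | h2 <;> rw [hτ, h2] <;> linarith
  set Abar : Matrix (Fin n) (Fin n) ℝ := traceCorrection c T with hAbar
  have hAbar' : Abar = U * Matrix.diagonal (fun i => g i / α + τ) * U.transpose :=
    traceCorrection_conj_diagonal hU c _
  have hAbarT : Abar = T + τ • (1 : Matrix (Fin n) (Fin n) ℝ) := by
    rw [hAbar, traceCorrection, hT, trace_conj_diagonal hU]
  have hAbartr : Abar.trace = n * (m + τ) := by
    rw [hAbar', trace_conj_diagonal hU, Finset.sum_add_distrib, hm]
    simp only [Finset.sum_const, Finset.card_univ, Fintype.card_fin, nsmul_eq_mul]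
    field_simp
  set a : ℝ := Real.sqrt (3 * γ / D) + 1 / Real.sqrt D with ha
  have hsqrt : Real.sqrt n ≤ n * (1 / Real.sqrt D) := by
    have h1 : 0 < Real.sqrt D := Real.sqrt_pos.2 hD0
    rw [mul_one_div, le_div_iff₀ h1]
    calc Real.sqrt n * Real.sqrt D ≤ Real.sqrt n * Real.sqrt n := by gcongr
      _ = n := Real.mul_self_sqrt hn'.le
  have hAbarK : frobeniusNorm (Abar - K) ≤ n * a := by
    have h1 : Abar - K = (T - K) + τ • (1 : Matrix (Fin n) (Fin n) ℝ) := by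
      rw [hAbarT]; abel
    rw [h1]
    refine (frobeniusNorm_add_le _ _).trans ?_
    rw [frobeniusNorm_smul, frobeniusNorm_one, abs_of_nonneg hτ0, ha, mul_add]
    refine add_le_add hTK (le_trans ?_ hsqrt)
    exact mul_le_of_le_one_left (Real.sqrt_nonneg _) hτ1
  have hKn : frobeniusNorm K ≤ n := by
    rw [frobeniusNorm_eq]
    refine Real.sqrt_le_iff.2 ⟨hn'.le, ?_⟩
    calc ∑ i, ∑ j, K i j ^ 2 ≤ ∑ _i : Fin n, ∑ _j : Fin n, (1 : ℝ) := by
          refine Finset.sum_le_sum fun i _ => Finset.sum_le_sum fun j _ => ?_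
          rw [← sq_abs]
          exact pow_le_one₀ (abs_nonneg _) (hK1 i j)
      _ = (n : ℝ) ^ 2 := by simp [sq]
  -- the rescaling
  set η : ℝ := E / D + 1 / D with hη
  have hη0 : 0 ≤ η := by positivity
  have hgη : ∀ i, g i / α + τ ≤ n * (1 + η) := by
    intro i
    have h1 := thresholded_le (γ := γ) hNpos hE hNE i
    rw [hNtr] at h1
    have h2 : g i ≤ D + E :=
      h1.trans (add_le_add (mul_le_of_le_one_right hD0.le hc1) le_rfl)
    have h3 : g i / α ≤ n * (1 + E / D) := by
      rw [div_le_iff₀ hα0]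
      refine h2.trans_eq ?_
      rw [hD]
      field_simp
    have h4 : (1 : ℝ) ≤ n * (1 / D) := by
      rw [mul_one_div, one_le_div hD0]
      exact hDn
    rw [hη]
    nlinarith
  obtain ⟨s, hs0, hs1, hs, hsA⟩ := exists_spectralRescaling_eq hU hn hα0
    (fun i => add_nonneg (div_nonneg (hg0 i) hα0.le) hτ0) hη0 hgη
  have hKn_eq : usvtKernel α c γ A hA = s • Abar := by
    rw [usvtKernel, hTeq, ← hAbar, hAbar']
    exact hsA
  have ha0 : 0 ≤ a := by positivity
  have hEγ0 : 0 ≤ 2 * E / γ := by positivity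
  rw [hKn_eq]
  refine max_le ?_ ?_
  · have h1 : s • Abar - K = s • (Abar - K) + (s - 1) • K := by
      rw [smul_sub, sub_smul, one_smul]; abel
    rw [frobeniusNorm_smul, abs_of_pos (by positivity), h1, one_div, inv_mul_le_iff₀ hn']
    refine (frobeniusNorm_add_le _ _).trans ?_
    rw [frobeniusNorm_smul, frobeniusNorm_smul, abs_of_nonneg hs0, abs_of_nonpos (by linarith)]
    have h2 : s * frobeniusNorm (Abar - K) ≤ n * a :=
      (mul_le_of_le_one_left (by rw [frobeniusNorm_eq]; exact Real.sqrt_nonneg _) hs1).trans hAbarK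
    have h3 : -(s - 1) * frobeniusNorm K ≤ (1 - s) * n := by
      rw [neg_sub]
      exact mul_le_mul_of_nonneg_left hKn (by linarith)
    nlinarith
  · have h1 : ((1 / (n : ℝ)) • s • Abar).trace - ((1 / (n : ℝ)) • K).trace =
        s * (m + τ - c) - (1 - s) * c := by
      rw [Matrix.trace_smul, Matrix.trace_smul, Matrix.trace_smul, hAbartr, hKtr]
      simp only [smul_eq_mul]
      field_simp
      ring
    rw [h1]
    have h2 : s * (m + τ - c) ≤ m + τ - c := mul_le_of_le_one_left (by linarith) hs1
    have h3 : 0 ≤ s * (m + τ - c) := mul_nonneg hs0 (by linarith)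
    have h4 : (1 - s) * c ≤ 1 - s := mul_le_of_le_one_right (by linarith) hc1
    have h5 : 0 ≤ (1 - s) * c := mul_nonneg (by linarith) hc0
    rw [abs_le]
    constructor <;> linarith

end Estimator

/-- The choice of the threshold constant. With `E = R √D` and `γ = ρ D ^ (3 / 4)`, every term of the
error bound is a positive power of `D ^ (-1 / 8)`, and the lowest of these powers is the first, which
comes from the Frobenius error `√(3 γ / D)`. -/
theorem exists_threshold_constants {R D₀ : ℝ} (hR : 0 < R) (hD₀ : 0 < D₀) :
    ∃ ρ Γ : ℝ, 0 < ρ ∧ 0 < Γ ∧ ∀ D, D₀ ≤ D →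
      2 * (R * Real.sqrt D) ≤ ρ * D ^ (3 / 4 : ℝ) ∧
      2 * (Real.sqrt (3 * (ρ * D ^ (3 / 4 : ℝ)) / D) + 1 / Real.sqrt D) +
        2 * (R * Real.sqrt D) / (ρ * D ^ (3 / 4 : ℝ)) +
        (R * Real.sqrt D / D + 1 / D + 1 / D ^ (1 / 4 : ℝ)) ≤ Γ * D ^ (-(1 / 8) : ℝ) := by
  -- the largest value of `D ^ (-1 / 8)`
  obtain ⟨x₀, hx₀0, hx₀⟩ : ∃ x₀ : ℝ, 0 < x₀ ∧ D₀ ^ (-(1 / 8) : ℝ) = x₀ :=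
    ⟨_, Real.rpow_pos_of_pos hD₀ _, rfl⟩
  obtain ⟨ρ, hρ⟩ : ∃ ρ : ℝ, ρ = 2 * R * x₀ ^ 2 := ⟨_, rfl⟩
  have hρ0 : 0 < ρ := by rw [hρ]; positivity
  refine ⟨ρ, 2 * (Real.sqrt (3 * ρ) + x₀ ^ 3) + 2 * R / ρ * x₀ + (R * x₀ ^ 3 + x₀ ^ 7 + x₀), hρ0,
    by positivity, fun D hD => ?_⟩
  have hD0 : 0 < D := hD₀.trans_le hD
  obtain ⟨x, hx0, hx⟩ : ∃ x : ℝ, 0 < x ∧ D ^ (-(1 / 8) : ℝ) = x :=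
    ⟨_, Real.rpow_pos_of_pos hD0 _, rfl⟩
  have hxx₀ : x ≤ x₀ := by
    rw [← hx, ← hx₀]
    exact Real.rpow_le_rpow_of_nonpos hD₀ hD (by norm_num)
  have hxpow : ∀ k : ℕ, x ^ k = D ^ (-(k / 8) : ℝ) := by
    intro k
    rw [← hx, ← Real.rpow_natCast, ← Real.rpow_mul hD0.le]
    congr 1
    ring
  have hx8 : 1 / D = x ^ 8 := by
    rw [hxpow, show (-((8 : ℕ) / 8) : ℝ) = -1 by norm_num, Real.rpow_neg_one, one_div]
  have hx4 : 1 / Real.sqrt D = x ^ 4 := by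
    rw [hxpow, show (-((4 : ℕ) / 8) : ℝ) = -(1 / 2) by norm_num, Real.rpow_neg hD0.le,
      ← Real.sqrt_eq_rpow, one_div]
  have hx2 : 1 / D ^ (1 / 4 : ℝ) = x ^ 2 := by
    rw [hxpow, show (-((2 : ℕ) / 8) : ℝ) = -(1 / 4) by norm_num, Real.rpow_neg hD0.le,
      inv_eq_one_div]
  have hD34 : D ^ (3 / 4 : ℝ) = 1 / x ^ 6 := by
    rw [hxpow, show (-((6 : ℕ) / 8) : ℝ) = -(3 / 4) by norm_num, Real.rpow_neg hD0.le, one_div,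
      inv_inv]
  have hsqrt : Real.sqrt D = 1 / x ^ 4 := by
    rw [← hx4, one_div_one_div]
  have e1 : Real.sqrt (3 * (ρ * D ^ (3 / 4 : ℝ)) / D) = Real.sqrt (3 * ρ) * x := by
    have h1 : 3 * (ρ * D ^ (3 / 4 : ℝ)) / D = 3 * ρ * x ^ 2 := by
      rw [div_eq_mul_one_div, hx8, hD34]
      field_simp
    rw [h1, Real.sqrt_mul (by positivity), Real.sqrt_sq hx0.le]
  have e2 : 2 * (R * Real.sqrt D) / (ρ * D ^ (3 / 4 : ℝ)) = 2 * R / ρ * x ^ 2 := by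
    rw [hsqrt, hD34]
    field_simp
  have e3 : R * Real.sqrt D / D = R * x ^ 4 := by
    rw [div_eq_mul_one_div, hx8, hsqrt]
    field_simp
  refine ⟨?_, ?_⟩
  · rw [hsqrt, hD34, mul_one_div, mul_one_div, ← mul_div_assoc,
      div_le_div_iff₀ (by positivity) (by positivity), hρ]
    have h1 : x ^ 2 ≤ x₀ ^ 2 := pow_le_pow_left₀ hx0.le hxx₀ 2
    calc 2 * R * x ^ 6 = 2 * R * x ^ 2 * x ^ 4 := by ring
      _ ≤ 2 * R * x₀ ^ 2 * x ^ 4 := by gcongr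
  · have hxk : ∀ k : ℕ, x ^ (k + 1) ≤ x₀ ^ k * x := fun k => by
      rw [pow_succ]
      exact mul_le_mul_of_nonneg_right (pow_le_pow_left₀ hx0.le hxx₀ k) hx0.le
    have k2 : x ^ 2 ≤ x₀ * x := by simpa using hxk 1
    have k4 : x ^ 4 ≤ x₀ ^ 3 * x := hxk 3
    have k8 : x ^ 8 ≤ x₀ ^ 7 * x := hxk 7
    have p2 : 2 * R / ρ * x ^ 2 ≤ 2 * R / ρ * (x₀ * x) :=
      mul_le_mul_of_nonneg_left k2 (by positivity)
    have p4 : R * x ^ 4 ≤ R * (x₀ ^ 3 * x) := mul_le_mul_of_nonneg_left k4 hR.le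
    rw [e1, e2, e3, hx8, hx4, hx2, hx]
    calc 2 * (Real.sqrt (3 * ρ) * x + x ^ 4) + 2 * R / ρ * x ^ 2 + (R * x ^ 4 + x ^ 8 + x ^ 2)
        ≤ 2 * (Real.sqrt (3 * ρ) * x + x₀ ^ 3 * x) + 2 * R / ρ * (x₀ * x) +
          (R * (x₀ ^ 3 * x) + x₀ ^ 7 * x + x₀ * x) := by gcongr
      _ = _ := by ring

theorem proposition7p1 (κ : ℝ) (hκ : 0 < κ) (q : ℝ) (hq : 0 < q) :
    ∃ ρ b B : ℝ, 0 < ρ ∧ 0 < b ∧ 0 < B ∧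
      ∀ (d : ℕ) (S : Set (EuclideanSpace ℝ (Fin d))), IsCompact S →
      ∀ (μ : Measure S), IsProbabilityMeasure μ →
      ∀ (W : S → S → ℝ), IsConnectivityKernel μ W →
      ∀ (c : ℝ), (∀ x, W x x = c) →
      ∀ (n : ℕ) (α : ℝ), 0 < α → α ≤ 1 → κ * (Real.log n / n) ≤ α →
      ∀ (Ω : Type*) [MeasurableSpace Ω] (P : Measure Ω), IsProbabilityMeasure P →
      ∀ (X : Fin n → Ω → S) (A : Ω → Matrix (Fin n) (Fin n) ℝ)
        (hG : IsLatentPositionGraph P μ W α X A),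
      ∀ (δ ε : ℝ), 0 < δ → δ < 1 → 0 < ε →
        max (1 / δ ^ q) (max (b / (α * ε ^ 8)) (B / (α * ε ^ 4))) ≤ (n : ℝ) →
        P {ω | ε ≤ max
            (frobeniusNorm ((1 / (n : ℝ)) •
              (usvtKernel α c (ρ * (α * n) ^ (3 / 4 : ℝ)) (A ω) (hG.isHermitian ω) -
                gramMatrix W (fun i => X i ω))))
            |((1 / (n : ℝ)) • usvtKernel α c (ρ * (α * n) ^ (3 / 4 : ℝ)) (A ω)
                (hG.isHermitian ω)).trace -
              ((1 / (n : ℝ)) • gramMatrix W (fun i => X i ω)).trace|} ≤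
          ENNReal.ofReal δ := by
  obtain ⟨C, hC, hconc⟩ := exists_spectral_concentration hκ hq
  have hlog2 : 0 < Real.log 2 := Real.log_pos (by norm_num)
  have hR0 : 0 < Real.sqrt C := Real.sqrt_pos.2 hC
  obtain ⟨ρ, Γ, hρ0, hΓ0, hΓ⟩ := exists_threshold_constants hR0 (mul_pos hκ hlog2)
  -- `Γ + 1` rather than `Γ`, because the error has to be strictly less than `ε`
  refine ⟨ρ, (Γ + 1) ^ 8, 1, hρ0, by positivity, one_pos, ?_⟩
  intro d S hS μ hμ W hW c hc n α hα0 hα1 hκα Ω _ P hP X A hG δ ε hδ0 hδ1 hε hnmax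
  have : CompactSpace S := isCompact_iff_compactSpace.1 hS
  have hnδ : 1 / δ ^ q ≤ n := (le_max_left _ _).trans hnmax
  have hnε : (Γ + 1) ^ 8 / (α * ε ^ 8) ≤ n :=
    (le_max_left _ _).trans ((le_max_right _ _).trans hnmax)
  have hn2 : 2 ≤ n := by
    have h1 : (1 : ℝ) < 1 / δ ^ q :=
      (one_lt_div (by positivity)).2 (Real.rpow_lt_one hδ0.le hδ1 hq)
    exact_mod_cast h1.trans_le hnδ
  have hn0 : (0 : ℝ) < n := by positivity
  set D : ℝ := α * n with hD
  have hD0 : 0 < D := by positivity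
  have hD2 : κ * Real.log 2 ≤ D := by
    have h1 := mul_le_mul_of_nonneg_right hκα hn0.le
    rw [mul_assoc, div_mul_cancel₀ _ hn0.ne'] at h1
    have h2 : Real.log 2 ≤ Real.log n := Real.log_le_log (by norm_num) (by exact_mod_cast hn2)
    exact (mul_le_mul_of_nonneg_left h2 hκ.le).trans h1
  obtain ⟨hEγ, herr⟩ := hΓ D hD2
  have hΓε : Γ * D ^ (-(1 / 8) : ℝ) < ε := by
    have hx0 : 0 < D ^ (-(1 / 8) : ℝ) := by positivity
    have h2 : (Γ + 1) * D ^ (-(1 / 8) : ℝ) ≤ ε := by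
      refine le_of_pow_le_pow_left₀ (n := 8) (by norm_num) hε.le ?_
      have h8 : (D ^ (-(1 / 8) : ℝ)) ^ 8 = 1 / D := by
        rw [← Real.rpow_natCast, ← Real.rpow_mul hD0.le,
          show (-(1 / 8) * (8 : ℕ) : ℝ) = -1 by norm_num, Real.rpow_neg_one, one_div]
      rw [mul_pow, h8, mul_one_div, div_le_iff₀ hD0, hD]
      rw [div_le_iff₀ (by positivity)] at hnε
      exact hnε.trans_eq (by ring)
    linarith
  have hprob : (n : ℝ) ^ (-(1 / q)) ≤ δ := by
    have h1 : (δ ^ q)⁻¹ ≤ n := by rwa [← one_div]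
    have h2 : (n : ℝ) ^ (-(1 / q)) ≤ ((δ ^ q)⁻¹) ^ (-(1 / q)) :=
      Real.rpow_le_rpow_of_nonpos (by positivity) h1 (by
        have : 0 < 1 / q := by positivity
        linarith)
    refine h2.trans_eq ?_
    rw [Real.rpow_neg (by positivity), Real.inv_rpow (by positivity), inv_inv,
      ← Real.rpow_mul hδ0.le, mul_one_div_cancel hq.ne', Real.rpow_one]
  refine le_trans (measure_mono_ae ?_)
    ((hconc hW hG hn2 hα0 hα1 hκα).trans (ENNReal.ofReal_le_ofReal hprob))
  filter_upwards [ae_posSemidef_gramMatrix hW hG.measurable_position hG.law_position] with ω hω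
  intro hbad hgood
  refine (not_lt.2 hbad) (lt_of_le_of_lt ?_ hΓε)
  refine (usvtKernel_error_le (by omega) hα0 hα1 hω (fun i j => ?_) (fun i => hc _)
    (hG.isHermitian ω) (by positivity) (by positivity) hEγ ?_).trans herr
  · have h1 := hW.mem_Icc (X i ω) (X j ω)
    exact abs_le.2 ⟨neg_one_lt_zero.le.trans h1.1, h1.2⟩
  · rw [mul_pow, Real.sq_sqrt hC.le, Real.sq_sqrt hD0.le]
    exact hgood
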